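/- Let $\mathscr{A}$ be a bicategory and $F\colon\mathscr{A}\to\mathbf{Cat}$ a pseudofunctor, where $\mathbf{Cat}$ is taken in a universe relative to which $\mathscr{A}$ is small (in the statements about colimits; the values of $F$ are included into this $\mathbf{Cat}$). *Lax conical colimits.* For a category $\mathcal{J}$, a bicategory $\mathscr{K}$ and a pseudofunctor $D\colon\mathcal{J}\to\mathscr{K}$, a lax cocone with vertex $T$ consists of 1-cells $\varphi_j\colon Dj\to T$ for all $j\in\mathcal J$ and 2-cells $\varphi_f\colon\varphi_k\cdot Df\Rightarrow\varphi_j$ for all $f\colon j\to k$, compatible with the unit and composition constraints of $D$; lax cocones with vertex $T$ form a category, with modifications as morphisms. The vertex $T$ is a lax conical colimit of $D$ if for every $S\in\mathscr{K}$ composition with $\varphi$ is an equivalence from $\mathscr{K}(T,S)$ to the category of lax cocones with vertex $S$. The pseudofunctor $F$ is a *lax conical colimit of representables*, written $F\simeq\int_{\mathrm{lax}}^{m\in\mathfrak{M}}\mathscr{A}(P_m,-)$, if there are a category $\mathfrak{M}$ and a pseudofunctor $P\colon\mathfrak{M}\to\mathscr{A}$ such that $F$ is a lax conical colimit of the diagram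 $\mathfrak{M}^{\mathrm{op}}\to[\mathscr{A},\mathbf{Cat}]$, $m\mapsto\mathscr{A}(P_m,-)$, in the 2-category $[\mathscr{A},\mathbf{Cat}]$ of pseudofunctors, pseudonatural transformations and modifications. *Elements.* The bicategory $\mathrm{el}\,F$ has as objects pairs $(A,x)$ with $A\in\mathscr{A}$ and $x\in FA$; a morphism $(A,x)\to(B,y)$ is a pair $(f,\alpha)$ with $f\colon A\to B$ in $\mathscr{A}$ and $\alpha\colon Ff(x)\to y$ in $FB$, called *opcartesian* if $\alpha$ is invertible; a 2-cell $(f,\alpha)\Rightarrow(g,\beta)$ is a 2-cell $\nu\colon f\Rightarrow g$ in $\mathscr{A}$ with $\beta\circ(F\nu)_x=\alpha$. *Generics.* In a bicategory, given $f\colon A\to B$ and $g\colon C\to B$, a pair $(h\colon A\to C,\ \nu\colon f\Rightarrow gh)$ is a *strong mixed left lifting* of $f$ through $g$ if for every $k\colon A\to C$ and $\psi\colon f\Rightarrow gk$ there is a unique $\lambda\colon k\Rightarrow h$ with $(g\lambda)\circ\psi=\nu$, and moreover any two parallel 2-cells into $h$ are equal. An object $X$ of $\mathrm{el}\,F$ is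 *lax el-generic* if for every $f\colon X\to Y$ and every opcartesian $g\colon Z\to Y$ there is a strong mixed left lifting $(h,\nu)$ of $f$ through $g$, where moreover $h$ is opcartesian and $\nu$ is invertible whenever $f$ is opcartesian. A morphism $\ell\colon X\to Y$ out of a lax el-generic object is *el-generic* if $\ell$, with the canonical 2-cell $\ell\Rightarrow 1_Y\ell$, is a strong mixed left lifting of $\ell$ through $1_Y$. Then the following are equivalent: 1. $F$ is a lax conical colimit of representables; 2. (a) for every object $Y$ of $\mathrm{el}\,F$ there are a lax el-generic object $X$ and an opcartesian morphism $X\to Y$; and (b) if $X,Y,Z$ are lax el-generic objects and $f\colon X\to Y$ and $g\colon Y\to Z$ are el-generic morphisms, then $gf$ is el-generic. -/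

import Mathlib

open CategoryTheory Bicategory Opposite
open scoped CategoryTheory.Pseudofunctor.StrongTrans

universe t w v u v₁ u₁ w₂ v₂ u₂

namespace LaxFamilial

/-! ### Mixed left liftings in a bicategory -/

section MixedLifting

variable {C : Type u} [Bicategory.{w, v} C]

/-- `ν : f ⟶ h ≫ g` exhibits `h` as the mixed left lifting of `f` through `g`: every
`ψ : f ⟶ k ≫ g` gives a unique `k ⟶ h` (note the direction) that pastes with `ψ` to `ν`. -/
def IsMixedLeftLifting {a b c : C} (f : a ⟶ b) (g : c ⟶ b) (h : a ⟶ c) (ν : f ⟶ h ≫ g) : Prop :=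
  ∀ (k : a ⟶ c) (ψ : f ⟶ k ≫ g), ∃! l : k ⟶ h, ψ ≫ l ▷ g = ν

/-- An object is subterminal if any two morphisms into it with the same source are equal. -/
def IsSubterminalObj {D : Type u} [Category.{v} D] (I : D) : Prop :=
  ∀ ⦃X : D⦄ (p q : X ⟶ I), p = q

/-- A mixed left lifting is strong if the lifting is subterminal in its hom-category. -/
def IsStrongMixedLeftLifting {a b c : C} (f : a ⟶ b) (g : c ⟶ b) (h : a ⟶ c)
    (ν : f ⟶ h ≫ g) : Prop :=
  IsMixedLeftLifting f g h ν ∧ IsSubterminalObj h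

end MixedLifting

/-! ### The bicategory of elements -/

section Elements

variable {A : Type u} [Bicategory.{w, v} A]

/-- Objects of the bicategory of elements of `F`. -/
structure El (F : A ⥤ᵖ Cat.{v₁, u₁}) where
  base : A
  fiber : F.obj base

namespace El

variable {F : A ⥤ᵖ Cat.{v₁, u₁}}

/-- A morphism `(A, x) ⟶ (B, y)` is a pair of `f : A ⟶ B` and `F f x ⟶ y`. -/
structure Hom (X Y : El F) where
  base : X.base ⟶ Y.base
  fiber : (F.map base).toFunctor.obj X.fiber ⟶ Y.fiber

instance categoryStruct : CategoryStruct (El F) where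
  Hom X Y := Hom X Y
  id X := ⟨𝟙 X.base, (F.mapId X.base).hom.toNatTrans.app X.fiber⟩
  comp {X _ _} f g := ⟨f.base ≫ g.base,
    (F.mapComp f.base g.base).hom.toNatTrans.app X.fiber ≫
      (F.map g.base).toFunctor.map f.fiber ≫ g.fiber⟩

/-- A 2-cell `(f, α) ⟶ (g, β)` is a 2-cell `f ⟶ g` of the base compatible with `α`, `β`. -/
@[ext]
structure Hom₂ {X Y : El F} (f g : X ⟶ Y) where
  base : f.base ⟶ g.base
  w : (F.map₂ base).toNatTrans.app X.fiber ≫ g.fiber = f.fiber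

instance homCategory (X Y : El F) : Category (X ⟶ Y) where
  Hom f g := Hom₂ f g
  id f := ⟨𝟙 f.base, by simp⟩
  comp p q := ⟨p.base ≫ q.base, by simp [q.w, p.w]⟩
  id_comp p := Hom₂.ext (Category.id_comp p.base)
  comp_id p := Hom₂.ext (Category.comp_id p.base)
  assoc p q r := Hom₂.ext (Category.assoc p.base q.base r.base)

theorem hom₂_ext {X Y : El F} {f g : X ⟶ Y} {p q : f ⟶ g} (h : p.base = q.base) : p = q :=
  Hom₂.ext h

/-- An invertible 2-cell of the base that underlies a 2-cell of elements is invertible there. -/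
def isoMk {X Y : El F} {f g : X ⟶ Y} (e : f.base ≅ g.base)
    (h : (F.map₂ e.hom).toNatTrans.app X.fiber ≫ g.fiber = f.fiber) : f ≅ g where
  hom := ⟨e.hom, h⟩
  inv := ⟨e.inv, by
    rw [← h, ← Category.assoc, ← Cat.Hom₂.comp_app, ← PrelaxFunctor.map₂_comp]
    simp⟩
  hom_inv_id := hom₂_ext e.hom_inv_id
  inv_hom_id := hom₂_ext e.inv_hom_id

theorem whiskerLeft_w {X Y Z : El F} (f : X ⟶ Y) {g h : Y ⟶ Z} (η : g ⟶ h) :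
    (F.map₂ (f.base ◁ η.base)).toNatTrans.app X.fiber ≫ (f ≫ h).fiber = (f ≫ g).fiber := by
  change _ ≫ (F.mapComp f.base h.base).hom.toNatTrans.app X.fiber ≫
      (F.map h.base).toFunctor.map f.fiber ≫ h.fiber =
    (F.mapComp f.base g.base).hom.toNatTrans.app X.fiber ≫
      (F.map g.base).toFunctor.map f.fiber ≫ g.fiber
  rw [F.map₂_whisker_left_app, ← η.w]
  simp

theorem whiskerRight_w {X Y Z : El F} {f g : X ⟶ Y} (η : f ⟶ g) (h : Y ⟶ Z) :
    (F.map₂ (η.base ▷ h.base)).toNatTrans.app X.fiber ≫ (g ≫ h).fiber = (f ≫ h).fiber := by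
  change _ ≫ (F.mapComp g.base h.base).hom.toNatTrans.app X.fiber ≫
      (F.map h.base).toFunctor.map g.fiber ≫ h.fiber =
    (F.mapComp f.base h.base).hom.toNatTrans.app X.fiber ≫
      (F.map h.base).toFunctor.map f.fiber ≫ h.fiber
  rw [F.map₂_whisker_right_app, ← η.w]
  simp

theorem associator_w {X Y Z W : El F} (f : X ⟶ Y) (g : Y ⟶ Z) (h : Z ⟶ W) :
    (F.map₂ (α_ f.base g.base h.base).hom).toNatTrans.app X.fiber ≫ (f ≫ g ≫ h).fiber =
      ((f ≫ g) ≫ h).fiber := by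
  change _ ≫ (F.mapComp f.base (g.base ≫ h.base)).hom.toNatTrans.app X.fiber ≫
      (F.map (g.base ≫ h.base)).toFunctor.map f.fiber ≫
        (F.mapComp g.base h.base).hom.toNatTrans.app Y.fiber ≫
          (F.map h.base).toFunctor.map g.fiber ≫ h.fiber =
    (F.mapComp (f.base ≫ g.base) h.base).hom.toNatTrans.app X.fiber ≫
      (F.map h.base).toFunctor.map ((F.mapComp f.base g.base).hom.toNatTrans.app X.fiber ≫
        (F.map g.base).toFunctor.map f.fiber ≫ g.fiber) ≫ h.fiber
  rw [F.map₂_associator_app]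
  simp

theorem leftUnitor_w {X Y : El F} (f : X ⟶ Y) :
    (F.map₂ (λ_ f.base).hom).toNatTrans.app X.fiber ≫ f.fiber = (𝟙 X ≫ f).fiber := by
  change _ = (F.mapComp (𝟙 X.base) f.base).hom.toNatTrans.app X.fiber ≫
      (F.map f.base).toFunctor.map ((F.mapId X.base).hom.toNatTrans.app X.fiber) ≫ f.fiber
  rw [F.map₂_left_unitor_app]
  simp

theorem rightUnitor_w {X Y : El F} (f : X ⟶ Y) :
    (F.map₂ (ρ_ f.base).hom).toNatTrans.app X.fiber ≫ f.fiber = (f ≫ 𝟙 Y).fiber := by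
  change _ = (F.mapComp f.base (𝟙 Y.base)).hom.toNatTrans.app X.fiber ≫
      (F.map (𝟙 Y.base)).toFunctor.map f.fiber ≫ (F.mapId Y.base).hom.toNatTrans.app Y.fiber
  rw [F.map₂_right_unitor_app]
  simp

instance bicategory : Bicategory (El F) where
  homCategory := homCategory
  whiskerLeft f _ _ η := ⟨f.base ◁ η.base, whiskerLeft_w f η⟩
  whiskerRight η h := ⟨η.base ▷ h.base, whiskerRight_w η h⟩
  associator f g h := isoMk (α_ f.base g.base h.base) (associator_w f g h)
  leftUnitor f := isoMk (λ_ f.base) (leftUnitor_w f)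
  rightUnitor f := isoMk (ρ_ f.base) (rightUnitor_w f)
  whiskerLeft_id _ _ := hom₂_ext (whiskerLeft_id _ _)
  whiskerLeft_comp _ _ _ _ _ _ := hom₂_ext (whiskerLeft_comp _ _ _)
  id_whiskerLeft _ := hom₂_ext (id_whiskerLeft _)
  comp_whiskerLeft _ _ _ _ _ := hom₂_ext (comp_whiskerLeft _ _ _)
  id_whiskerRight _ _ := hom₂_ext (id_whiskerRight _ _)
  comp_whiskerRight _ _ _ := hom₂_ext (comp_whiskerRight _ _ _)
  whiskerRight_id _ := hom₂_ext (whiskerRight_id _)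
  whiskerRight_comp _ _ _ := hom₂_ext (whiskerRight_comp _ _ _)
  whisker_assoc _ _ _ _ _ := hom₂_ext (whisker_assoc _ _ _)
  whisker_exchange _ _ := hom₂_ext (whisker_exchange _ _)
  pentagon _ _ _ _ := hom₂_ext (pentagon _ _ _ _)
  triangle _ _ := hom₂_ext (triangle _ _)

/-- A morphism `(f, α)` of the bicategory of elements is opcartesian if `α` is invertible. -/
def IsOpcartesian {X Y : El F} (f : X ⟶ Y) : Prop := IsIso f.fiber

/-- Lax el-generic objects `X = (A, x)`: for every `f : X ⟶ Y` and every opcartesian `g : Z ⟶ Y`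
there is a strong mixed left lifting `h : X ⟶ Z` of `f` through `g`, exhibited by a 2-cell
`ν : f ⟶ h ≫ g`, and if `f` is opcartesian, then `h` is opcartesian and `ν` is invertible. -/
def IsLaxElGeneric (X : El F) : Prop :=
  ∀ ⦃Y Z : El F⦄ (f : X ⟶ Y) (g : Z ⟶ Y), IsOpcartesian g →
    ∃ (h : X ⟶ Z) (ν : f ⟶ h ≫ g), IsStrongMixedLeftLifting f g h ν ∧
      (IsOpcartesian f → IsOpcartesian h ∧ IsIso ν)

/-- El-generic morphisms out of a lax el-generic object: `f`, with the canonical 2-cell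
`f ⟶ f ≫ 𝟙 Y`, is the strong mixed left lifting of itself through the identity of its target. -/
def IsElGenericMor {X Y : El F} (f : X ⟶ Y) : Prop :=
  IsStrongMixedLeftLifting f (𝟙 Y) f (ρ_ f).inv

end El

end Elements

/-! ### Lax conical colimits -/

section LaxColimit

variable {J : Type u₁} [Bicategory.{w₂, v₁} J] {K : Type u} [Bicategory.{w, v} K]

/-- A lax cocone under the pseudofunctor `D` with vertex `T`: legs `ι a : D a ⟶ T` and, for every
`f : a ⟶ b`, a 2-cell `D f ≫ ι b ⟶ ι a`, compatible with the constraints of `D`; equivalently a lax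
natural transformation from the constant functor at the terminal category to `K(D -, T)`.
The index is a category regarded as a locally discrete bicategory (or its opposite). -/
structure LaxCocone (D : J ⥤ᵖ K) (T : K) where
  ι (a : J) : D.obj a ⟶ T
  cell {a b : J} (f : a ⟶ b) : D.map f ≫ ι b ⟶ ι a
  cell_naturality {a b : J} {f g : a ⟶ b} (η : f ⟶ g) : D.map₂ η ▷ ι b ≫ cell g = cell f
  cell_id (a : J) : cell (𝟙 a) = (D.mapId a).hom ▷ ι a ≫ (λ_ (ι a)).hom
  cell_comp {a b c : J} (f : a ⟶ b) (g : b ⟶ c) :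
    cell (f ≫ g) = (D.mapComp f g).hom ▷ ι c ≫ (α_ (D.map f) (D.map g) (ι c)).hom ≫
      D.map f ◁ cell g ≫ cell f

namespace LaxCocone

variable {D : J ⥤ᵖ K} {T : K}

/-- Morphisms of lax cocones (modifications). -/
@[ext]
structure Hom (c d : LaxCocone D T) where
  app (a : J) : c.ι a ⟶ d.ι a
  naturality {a b : J} (f : a ⟶ b) : D.map f ◁ app b ≫ d.cell f = c.cell f ≫ app a

instance category (D : J ⥤ᵖ K) (T : K) : Category (LaxCocone D T) where
  Hom := Hom
  id c := ⟨fun a => 𝟙 (c.ι a), by simp⟩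
  comp p q := ⟨fun a => p.app a ≫ q.app a, fun f => by
    rw [whiskerLeft_comp, Category.assoc, q.naturality, ← Category.assoc, p.naturality,
      Category.assoc]⟩
  id_comp p := Hom.ext (funext fun _ => Category.id_comp _)
  comp_id p := Hom.ext (funext fun _ => Category.comp_id _)
  assoc p q r := Hom.ext (funext fun _ => Category.assoc _ _ _)

/-- The lax cocone obtained from `c` by composing with `s : T ⟶ S`. -/
def whisker (c : LaxCocone D T) {S : K} (s : T ⟶ S) : LaxCocone D S where
  ι a := c.ι a ≫ s
  cell {a b} f := (α_ (D.map f) (c.ι b) s).inv ≫ c.cell f ▷ s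
  cell_naturality {a b f g} η := by
    rw [← c.cell_naturality η]; simp
  cell_id a := by
    rw [c.cell_id]; simp
  cell_comp {a b c'} f g := by
    rw [c.cell_comp]; simp

/-- The functor from `K(T, S)` to lax cocones with vertex `S` that composes with `c`. -/
def extend (c : LaxCocone D T) (S : K) : (T ⟶ S) ⥤ LaxCocone D S where
  obj s := c.whisker s
  map η := ⟨fun a => c.ι a ◁ η, fun {a b} f => by
    change D.map f ◁ c.ι b ◁ η ≫ (α_ _ _ _).inv ≫ c.cell f ▷ _ = ((α_ _ _ _).inv ≫ c.cell f ▷ _) ≫ _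
    rw [associator_inv_naturality_right_assoc, whisker_exchange, Category.assoc]⟩
  map_id s := Hom.ext (funext fun _ => whiskerLeft_id _ _)
  map_comp η θ := Hom.ext (funext fun _ => whiskerLeft_comp _ _ _)

/-- `c` exhibits its vertex as the lax conical colimit of `D`. -/
def IsLaxColimit (c : LaxCocone D T) : Prop := ∀ S : K, (c.extend S).IsEquivalence

end LaxCocone
end LaxColimit

/-! ### Representables -/

section Op

variable {B : Type u} [Bicategory.{w, v} B] {C : Type u₂} [Bicategory.{w₂, v₂} C]

open Bicategory.Opposite

/-- The pseudofunctor between the 1-cell duals induced by `P`. -/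
def opPseudofunctor (P : B ⥤ᵖ C) : Bᵒᵖ ⥤ᵖ Cᵒᵖ where
  obj X := op (P.obj X.unop)
  map f := (P.map f.unop).op
  map₂ η := op2 (P.map₂ η.unop2)
  map₂_id f := congrArg op2 (P.map₂_id f.unop)
  map₂_comp η θ := congrArg op2 (P.map₂_comp η.unop2 θ.unop2)
  mapId X := (P.mapId X.unop).op2
  mapComp f g := (P.mapComp g.unop f.unop).op2
  map₂_whisker_left f g h η := congrArg op2 (P.map₂_whisker_right η.unop2 f.unop)
  map₂_whisker_right η h := congrArg op2 (P.map₂_whisker_left h.unop η.unop2)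
  map₂_associator f g h := congrArg op2 (by
    have e : (P.map₂Iso (α_ h.unop g.unop f.unop)).inv = _ := congrArg Iso.inv (Iso.ext
      (P.map₂_associator h.unop g.unop f.unop) : P.map₂Iso (α_ h.unop g.unop f.unop) =
        P.mapComp (h.unop ≫ g.unop) f.unop ≪≫ whiskerRightIso (P.mapComp h.unop g.unop) _ ≪≫
          α_ _ _ _ ≪≫ whiskerLeftIso _ (P.mapComp g.unop f.unop).symm ≪≫
            (P.mapComp h.unop (g.unop ≫ f.unop)).symm)
    simpa using e)
  map₂_left_unitor f := congrArg op2 (P.map₂_right_unitor f.unop)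
  map₂_right_unitor f := congrArg op2 (P.map₂_left_unitor f.unop)

end Op

section Rep

/-- The image of a functor under `AsSmall`. -/
def smallFunctor {C : Type u} [Category.{v} C] {D : Type u₂} [Category.{v₂} D] (G : C ⥤ D) :
    AsSmall.{t} C ⥤ AsSmall.{t} D := AsSmall.down ⋙ G ⋙ AsSmall.up

/-- The image of a natural transformation under `AsSmall`. -/
def smallTrans {C : Type u} [Category.{v} C] {D : Type u₂} [Category.{v₂} D] {G H : C ⥤ D}
    (η : G ⟶ H) : smallFunctor.{t} G ⟶ smallFunctor.{t} H :=
  Functor.whiskerLeft AsSmall.down (Functor.whiskerRight η AsSmall.up)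

theorem cat_ext {C D : Cat.{v, u}} {G H : C ⟶ D} {p q : G ⟶ H}
    (h : ∀ x, p.toNatTrans.app x = q.toNatTrans.app x) : p = q :=
  Cat.Hom₂.ext (NatTrans.ext (funext h))

theorem small_hom_ext {C : Type u} [Category.{v} C] {X Y : AsSmall.{t} C} {p q : X ⟶ Y}
    (h : p.down = q.down) : p = q := ULift.ext _ _ h

/-- The inclusion of `Cat` into the `Cat` of a larger universe. -/
def catAsSmall : Cat.{v, u} ⥤ᵖ Cat.{max t v u, max t v u} where
  obj C := Cat.of (AsSmall.{t} C)
  map G := (smallFunctor.{t} G.toFunctor).toCatHom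
  map₂ η := (smallTrans.{t} η.toNatTrans).toCatHom₂
  map₂_id _ := cat_ext fun _ => rfl
  map₂_comp _ _ := cat_ext fun _ => rfl
  mapId C := Cat.Hom.isoMk (Iso.refl (𝟭 (AsSmall.{t} C)))
  mapComp G H := Cat.Hom.isoMk (Iso.refl (smallFunctor.{t} G.toFunctor ⋙ smallFunctor H.toFunctor))
  map₂_whisker_left f g h η := cat_ext fun x => small_hom_ext (by
    exact ((Category.id_comp _).trans (Category.comp_id _)).symm)
  map₂_whisker_right η h := cat_ext fun x => small_hom_ext (by
    exact ((Category.id_comp _).trans (Category.comp_id _)).symm)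
  map₂_associator f g h := cat_ext fun x => small_hom_ext (by
    have key : ∀ {C : Type u} {D : Type u} [Category.{v} C] [Category.{v} D] (G : C ⥤ D) (y : C),
        𝟙 (G.obj y) = 𝟙 _ ≫ G.map (𝟙 y) ≫ 𝟙 _ ≫ 𝟙 _ ≫ 𝟙 _ := by
      intros; simp
    exact key h.toFunctor _)
  map₂_left_unitor f := cat_ext fun x => small_hom_ext (by
    have key : ∀ {C : Type u} {D : Type u} [Category.{v} C] [Category.{v} D] (G : C ⥤ D) (y : C),
        𝟙 (G.obj y) = 𝟙 _ ≫ G.map (𝟙 y) ≫ 𝟙 _ := by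
      intros; simp
    exact key f.toFunctor _)
  map₂_right_unitor f := cat_ext fun x => small_hom_ext (by
    exact ((Category.id_comp _).trans (Category.comp_id _)).symm)

variable {A : Type u} [Bicategory.{w, v} A]

/-- The representable pseudofunctor `A(X, -)`. -/
def corep₀ (X : A) : A ⥤ᵖ Cat.{w, v} where
  obj T := Cat.of (X ⟶ T)
  map f := (postcomp X f).toCatHom
  map₂ η := ((postcomposing X _ _).map η).toCatHom₂
  map₂_id f := cat_ext fun h => whiskerLeft_id h f
  map₂_comp η θ := cat_ext fun h => whiskerLeft_comp h η θ
  mapId T := Cat.Hom.isoMk (NatIso.ofComponents (fun h => ρ_ h)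
    (fun η => rightUnitor_naturality η) : postcomp X (𝟙 T) ≅ 𝟭 (X ⟶ T))
  mapComp f g := Cat.Hom.isoMk (NatIso.ofComponents (fun h => (α_ h f g).symm)
    (fun η => associator_inv_naturality_left η f g) :
      postcomp X (f ≫ g) ≅ postcomp X f ⋙ postcomp X g)
  map₂_whisker_left {S _ _} f g h η := cat_ext fun x => by
    have key : ∀ x : X ⟶ S, x ◁ f ◁ η = (α_ x f g).inv ≫ (x ≫ f) ◁ η ≫ (α_ x f h).hom := by simp
    exact key x
  map₂_whisker_right {S _ _ f g} η h := cat_ext fun x => by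
    have key : ∀ x : X ⟶ S, x ◁ η ▷ h = (α_ x f h).inv ≫ (x ◁ η) ▷ h ≫ (α_ x g h).hom := by simp
    exact key x
  map₂_associator {S _ _ _} f g h := cat_ext fun x => by
    have key : ∀ x : X ⟶ S, x ◁ (α_ f g h).hom = (α_ x (f ≫ g) h).inv ≫ (α_ x f g).inv ▷ h ≫
      𝟙 _ ≫ (α_ (x ≫ f) g h).hom ≫ (α_ x f (g ≫ h)).hom := by simp
    exact key x
  map₂_left_unitor {S _} f := cat_ext fun x => by
    have key : ∀ x : X ⟶ S, x ◁ (λ_ f).hom = (α_ x _ f).inv ≫ (ρ_ x).hom ▷ f ≫ 𝟙 _ := by simp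
    exact key x
  map₂_right_unitor {S _} f := cat_ext fun x => by
    have key : ∀ x : X ⟶ S, x ◁ (ρ_ f).hom = (α_ x f _).inv ≫ (ρ_ (x ≫ f)).hom ≫ 𝟙 _ := by simp
    exact key x

/-- The representable `A(X, -)`, with values in the categories of a larger universe. -/
def smallCorep (X : A) : A ⥤ᵖ Cat.{max t w v, max t w v} := (corep₀ X).comp catAsSmall.{t}

/-- Precomposition with `f`, as a pseudonatural transformation `A(Y, -) ⟶ A(X, -)`. -/
def smallCorepMap {X Y : A} (f : X ⟶ Y) : smallCorep.{t} Y ⟶ smallCorep.{t} X where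
  app T := (smallFunctor.{t} (precomp T f)).toCatHom
  naturality {S T} g := Cat.Hom.isoMk (NatIso.ofComponents
    (fun h => AsSmall.up.mapIso (α_ f (AsSmall.down.obj h) g).symm)
    (fun η => small_hom_ext (associator_inv_naturality_middle f η.down g)) :
      smallFunctor.{t} (postcomp Y g) ⋙ smallFunctor.{t} (precomp T f) ≅
        smallFunctor.{t} (precomp S f) ⋙ smallFunctor.{t} (postcomp X g))
  naturality_naturality {S T g h} η := cat_ext fun x => small_hom_ext (by
    have key : ∀ x : Y ⟶ S, f ◁ x ◁ η ≫ (α_ f x h).inv = (α_ f x g).inv ≫ (f ≫ x) ◁ η := by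
      simp
    exact key (AsSmall.down.obj x))
  naturality_id T := cat_ext fun x => small_hom_ext (by
    have key : ∀ x : Y ⟶ T, (α_ f x (𝟙 T)).inv ≫ (ρ_ (f ≫ x)).hom ≫ 𝟙 _ =
      f ◁ ((ρ_ x).hom ≫ 𝟙 _) ≫ 𝟙 _ ≫ 𝟙 _ := by simp
    exact key (AsSmall.down.obj x))
  naturality_comp {S _ T} g h := cat_ext fun x => small_hom_ext (by
    have key : ∀ x : Y ⟶ S, (α_ f x (g ≫ h)).inv ≫ (α_ (f ≫ x) g h).inv ≫ 𝟙 _ =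
      f ◁ ((α_ x g h).inv ≫ 𝟙 _) ≫ 𝟙 _ ≫ (α_ f (x ≫ g) h).inv ≫ 𝟙 _ ≫
        (α_ f x g).inv ▷ h ≫ 𝟙 _ := by simp
    exact key (AsSmall.down.obj x))

/-- The modification induced by a 2-cell. -/
def smallCorepMap₂ {X Y : A} {f g : X ⟶ Y} (η : f ⟶ g) :
    smallCorepMap.{t} f ⟶ smallCorepMap.{t} g where
  as := {
    app T := (smallTrans.{t} ((precomposing X Y T).map η)).toCatHom₂
    naturality {S T} h := cat_ext fun x => small_hom_ext (by
      have key : ∀ x : Y ⟶ S, η ▷ (x ≫ h) ≫ (α_ g x h).inv = (α_ f x h).inv ≫ (η ▷ x) ▷ h := by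
        simp
      exact key (AsSmall.down.obj x)) }

theorem smallCorep_ext {X Y : A} {p q : smallCorep.{t} X ⟶ smallCorep.{t} Y} {m n : p ⟶ q}
    (h : ∀ (T : A) (x : AsSmall.{t} (X ⟶ T)),
      ((m.as.app T).toNatTrans.app x).down = ((n.as.app T).toNatTrans.app x).down) : m = n := by
  exact Pseudofunctor.StrongTrans.homCategory.ext fun T =>
    cat_ext fun x => small_hom_ext (h T x)

open Bicategory.Opposite

/-- The contravariant Yoneda pseudofunctor `X ↦ A(X, -)`. -/
def smallCoyoneda : Aᵒᵖ ⥤ᵖ (A ⥤ᵖ Cat.{max t w v, max t w v}) where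
  obj X := smallCorep.{t} X.unop
  map f := smallCorepMap.{t} f.unop
  map₂ η := smallCorepMap₂.{t} η.unop2
  map₂_id f := smallCorep_ext fun T x => id_whiskerRight f.unop (AsSmall.down.obj x)
  map₂_comp η θ := smallCorep_ext fun T x =>
    comp_whiskerRight η.unop2 θ.unop2 (AsSmall.down.obj x)
  mapId X := Pseudofunctor.StrongTrans.isoMk
    (fun T => Cat.Hom.isoMk (NatIso.ofComponents
      (fun h => AsSmall.up.mapIso (λ_ (AsSmall.down.obj h)))
      (fun η => small_hom_ext (leftUnitor_naturality η.down)) :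
        smallFunctor.{t} (precomp T (𝟙 X.unop)) ≅ 𝟭 _))
    (fun {S T} g => cat_ext fun x => small_hom_ext (by
      have key : ∀ x : X.unop ⟶ S, (λ_ (x ≫ g)).hom ≫ 𝟙 _ ≫ 𝟙 _ =
        (α_ (𝟙 X.unop) x g).inv ≫ (λ_ x).hom ▷ g := by simp
      exact key (AsSmall.down.obj x)))
  mapComp {X Y Z} f g := Pseudofunctor.StrongTrans.isoMk
    (fun T => Cat.Hom.isoMk (NatIso.ofComponents
      (fun h => AsSmall.up.mapIso (α_ g.unop f.unop (AsSmall.down.obj h)))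
      (fun η => small_hom_ext (associator_naturality_right g.unop f.unop η.down)) :
        smallFunctor.{t} (precomp T (g.unop ≫ f.unop)) ≅
          smallFunctor.{t} (precomp T f.unop) ⋙ smallFunctor.{t} (precomp T g.unop)))
    (fun {S T} k => cat_ext fun x => small_hom_ext (by
      have key : ∀ x : X.unop ⟶ S,
        (α_ g.unop f.unop (x ≫ k)).hom ≫ 𝟙 _ ≫ g.unop ◁ (α_ f.unop x k).inv ≫ 𝟙 _ ≫
          (α_ g.unop (f.unop ≫ x) k).inv ≫ 𝟙 _ =
        (α_ (g.unop ≫ f.unop) x k).inv ≫ (α_ g.unop f.unop x).hom ▷ k := by simp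
      exact key (AsSmall.down.obj x)))
  map₂_whisker_left {X Y Z} f g h η := smallCorep_ext fun T x => by
    have key : ∀ x : X.unop ⟶ T, (η.unop2 ▷ f.unop) ▷ x = (α_ g.unop f.unop x).hom ≫
      η.unop2 ▷ (f.unop ≫ x) ≫ (α_ h.unop f.unop x).inv := by simp
    exact key (AsSmall.down.obj x)
  map₂_whisker_right {X Y Z f g} η h := smallCorep_ext fun T x => by
    have key : ∀ x : X.unop ⟶ T, (h.unop ◁ η.unop2) ▷ x = (α_ h.unop f.unop x).hom ≫
      h.unop ◁ η.unop2 ▷ x ≫ (α_ h.unop g.unop x).inv := by simp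
    exact key (AsSmall.down.obj x)
  map₂_associator {X Y Z W} f g h := smallCorep_ext fun T x => by
    have key : ∀ x : X.unop ⟶ T, (α_ h.unop g.unop f.unop).inv ▷ x =
      (α_ h.unop (g.unop ≫ f.unop) x).hom ≫ h.unop ◁ (α_ g.unop f.unop x).hom ≫ 𝟙 _ ≫
        (α_ h.unop g.unop (f.unop ≫ x)).inv ≫ (α_ (h.unop ≫ g.unop) f.unop x).inv := by simp
    exact key (AsSmall.down.obj x)
  map₂_left_unitor {X Y} f := smallCorep_ext fun T x => by
    have key : ∀ x : X.unop ⟶ T, (ρ_ f.unop).hom ▷ x =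
      (α_ f.unop (𝟙 _) x).hom ≫ f.unop ◁ (λ_ x).hom ≫ 𝟙 _ := by simp
    exact key (AsSmall.down.obj x)
  map₂_right_unitor {X Y} f := smallCorep_ext fun T x => by
    have key : ∀ x : X.unop ⟶ T, (λ_ f.unop).hom ▷ x =
      (α_ (𝟙 _) f.unop x).hom ≫ (λ_ (f.unop ≫ x)).hom ≫ 𝟙 _ := by simp
    exact key (AsSmall.down.obj x)

end Rep

/-! ### Lax conical colimits of representables -/

/-- `F` is a lax conical colimit of representables: for some category `M` and pseudofunctor
`P : M ⟶ A`, it is the vertex of a lax colimit of the diagram `m ↦ A(P m, -)` indexed by the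
opposite of `M`, in the bicategory of pseudofunctors, pseudonatural transformations and
modifications. All categories are taken in one universe in which `A` and the values of `F` are
small. -/
def IsLaxConicalColimitOfRepresentables {A : Type u} [Bicategory.{w, v} A]
    (F : A ⥤ᵖ Cat.{v₁, u₁}) : Prop :=
  ∃ (M : Type (max u v w u₁ v₁)) (_ : Category.{max u v w u₁ v₁} M) (P : LocallyDiscrete M ⥤ᵖ A)
    (c : LaxCocone ((opPseudofunctor P).comp smallCoyoneda.{max u v w u₁ v₁})
      (F.comp catAsSmall.{max u v w u₁ v₁})), c.IsLaxColimit

end LaxFamilial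

/-! For a diagram `P`, the lax colimit of the representables is computed pointwise. Its value at `T`
is the category `Family P T` of pairs `(j, h : P j ⟶ T)`, in which a morphism `(j, h) ⟶ (k, h')` is
some `p : j ⟶ k` with a 2-cell `h ⟶ P p ≫ h'`. Each such morphism factors as a 2-cell over `𝟙 j`
(`vert`) followed by a cartesian morphism (`cart`), and a lax cocone prescribes exactly the values
on these two kinds (`familiesCocone_isLaxColimit`). Lax colimits are unique up to equivalence and
pointwise equivalences are equivalences, so the first condition says that some `s : families P ⟶ F`
is a pointwise equivalence (`isLaxConicalColimitOfRepresentables_iff`), up to the change of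
universe.

Given such an `s`, let `gen s j` be the element `s (j, 𝟙)`. If `y ≅ s b`, then a morphism `l : gen s
j ⟶ (B, y)` is transposed to a morphism of families `(j, l.base) ⟶ b`, that is, to some `p` and a
2-cell `ν`. Here `ν` is a 2-cell from `l` to a standard morphism `std β p` determined by `p`, and
the index `p` does not change along 2-cells. So the morphisms with index `p` form a category with
terminal object `std β p`; the generic morphisms are those isomorphic to a standard one, and
standard morphisms also provide the liftings that make `gen s j` lax el-generic. Essential
surjectivity of `s` gives (a). For (b), a morphism out of a lax el-generic object is generic iff its
fiber component corresponds to a pair `(p, ν)` with `ν` invertible (`isGenericObj_iff_isCart`). Such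
components are stable under composition and under the functors `F g`, hence generic morphisms
compose.

Conversely, assume (a) and (b). Lax el-generic objects and isomorphism classes of generic morphisms
form a category. Parallel 2-cells into a generic morphism are equal, so a choice of representatives
is automatically a pseudofunctor `Q` to `El F`. With `P` the projection of `Q` to `A`, the pair `(j,
h)` is sent to `F h` applied to the element `Q j`. Existence of strong liftings through opcartesian
morphisms makes this functor full, their uniqueness makes it faithful, and (a) makes it essentially
surjective (`PresentsGenerics.isEquivalence_fn`). -/

namespace LaxFamilial

/-! ### Lax colimits: transport along equivalences and uniqueness. -/

section Precomposition

variable {K : Type u} [Bicategory.{w, v} K] {S T : K}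

/-- Precomposition with an equivalence is an equivalence of hom-categories. -/
def precompEquivalence (s : T ⟶ S) (t : S ⟶ T) (e : s ≫ t ≅ 𝟙 T) (e' : t ≫ s ≅ 𝟙 S) (R : K) :
    CategoryTheory.Equivalence (S ⟶ R) (T ⟶ R) :=
  CategoryTheory.Equivalence.mk (precomp R s) (precomp R t)
    (NatIso.ofComponents
      (fun k => (λ_ k).symm ≪≫ whiskerRightIso e'.symm k ≪≫ α_ t s k)
      (fun {k l} η => by
        change η ≫ (λ_ l).inv ≫ e'.inv ▷ l ≫ (α_ t s l).hom =
          ((λ_ k).inv ≫ e'.inv ▷ k ≫ (α_ t s k).hom) ≫ t ◁ s ◁ η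
        rw [leftUnitor_inv_naturality_assoc, whisker_exchange_assoc, Category.assoc, Category.assoc,
          associator_naturality_right]))
    (NatIso.ofComponents
      (fun k => (α_ s t k).symm ≪≫ whiskerRightIso e k ≪≫ λ_ k)
      (fun {k l} η => by
        change s ◁ t ◁ η ≫ (α_ s t l).inv ≫ e.hom ▷ l ≫ (λ_ l).hom =
          ((α_ s t k).inv ≫ e.hom ▷ k ≫ (λ_ k).hom) ≫ η
        rw [associator_inv_naturality_right_assoc, whisker_exchange_assoc, leftUnitor_naturality,
          Category.assoc, Category.assoc]))

end Precomposition

namespace LaxCocone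

variable {J : Type u₁} [Bicategory.{w₂, v₁} J] {K : Type u} [Bicategory.{w, v} K]
variable {D : J ⥤ᵖ K} {R S T : K}

theorem hom_ext {c d : LaxCocone D T} {p q : c ⟶ d} (h : ∀ a, p.app a = q.app a) : p = q :=
  Hom.ext (funext h)

/-- An isomorphism of lax cocones from isomorphisms of the legs. -/
def isoMk {c d : LaxCocone D T} (e : ∀ a, c.ι a ≅ d.ι a)
    (h : ∀ {a b : J} (f : a ⟶ b), D.map f ◁ (e b).hom ≫ d.cell f = c.cell f ≫ (e a).hom) :
    c ≅ d where
  hom := ⟨fun a => (e a).hom, h⟩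
  inv := ⟨fun a => (e a).inv, fun {a b} f => by
    rw [← cancel_mono (e a).hom, Category.assoc, ← h]
    simp⟩
  hom_inv_id := hom_ext fun a => (e a).hom_inv_id
  inv_hom_id := hom_ext fun a => (e a).inv_hom_id

/-- Whiskering lax cocones with a fixed 1-cell is functorial. -/
def whiskering (D : J ⥤ᵖ K) (s : T ⟶ S) : LaxCocone D T ⥤ LaxCocone D S where
  obj c := c.whisker s
  map {c d} p := ⟨fun a => p.app a ▷ s, fun {a b} f => by
    change D.map f ◁ p.app b ▷ s ≫ (α_ _ _ _).inv ≫ d.cell f ▷ s =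
      ((α_ _ _ _).inv ≫ c.cell f ▷ s) ≫ p.app a ▷ s
    rw [associator_inv_naturality_middle_assoc, Category.assoc, ← comp_whiskerRight,
      ← comp_whiskerRight, p.naturality]⟩
  map_id c := hom_ext fun _ => id_whiskerRight _ _
  map_comp p q := hom_ext fun _ => comp_whiskerRight _ _ _

/-- Whiskering with a composite. -/
def whiskerComp (c : LaxCocone D T) (s : T ⟶ S) (r : S ⟶ R) :
    c.whisker (s ≫ r) ≅ (c.whisker s).whisker r :=
  isoMk (fun a => (α_ (c.ι a) s r).symm) (fun {a b} f => by
    change D.map f ◁ (α_ (c.ι b) s r).inv ≫ (α_ _ _ _).inv ≫ ((α_ _ _ _).inv ≫ c.cell f ▷ s) ▷ r =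
      ((α_ _ _ _).inv ≫ c.cell f ▷ (s ≫ r)) ≫ (α_ (c.ι a) s r).inv
    simp)

/-- Whiskering with an identity. -/
def whiskerId (c : LaxCocone D T) : c.whisker (𝟙 T) ≅ c :=
  isoMk (fun a => ρ_ (c.ι a)) (fun {a b} f => by
    change D.map f ◁ (ρ_ (c.ι b)).hom ≫ c.cell f =
      ((α_ _ _ _).inv ≫ c.cell f ▷ 𝟙 T) ≫ (ρ_ (c.ι a)).hom
    simp)

/-- Extending the whiskered cocone amounts to precomposing with the equivalence `s` and then
extending `c`, and both of these are equivalences. -/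
theorem IsLaxColimit.whisker {c : LaxCocone D T} (hc : c.IsLaxColimit) (s : T ⟶ S) (r : S ⟶ T)
    (e : s ≫ r ≅ 𝟙 T) (e' : r ≫ s ≅ 𝟙 S) : (c.whisker s).IsLaxColimit := fun R => by
  have := hc R
  have i : (precompEquivalence s r e e' R).functor ⋙ c.extend R ≅ (c.whisker s).extend R :=
    NatIso.ofComponents (fun k => c.whiskerComp s k) (fun {k l} η => hom_ext fun a => by
      change c.ι a ◁ s ◁ η ≫ (α_ _ _ _).inv = (α_ _ _ _).inv ≫ (c.ι a ≫ s) ◁ η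
      simp)
  exact Functor.isEquivalence_of_iso i

/-- The 1-cells `s ≫ r` and `𝟙 T` induce isomorphic cocones from `c`, and the fully faithful
`c.extend T` reflects this isomorphism. -/
theorem IsLaxColimit.exists_iso_id {c : LaxCocone D T} {d : LaxCocone D S} (hc : c.IsLaxColimit)
    {s : T ⟶ S} {r : S ⟶ T} (e : c.whisker s ≅ d) (e' : d.whisker r ≅ c) :
    Nonempty (s ≫ r ≅ 𝟙 T) := by
  have := hc T
  exact ⟨(c.extend T).preimageIso
    (c.whiskerComp s r ≪≫ (whiskering D r).mapIso e ≪≫ e' ≪≫ c.whiskerId.symm)⟩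

theorem IsLaxColimit.exists_equivalence {c : LaxCocone D T} {d : LaxCocone D S}
    (hc : c.IsLaxColimit) (hd : d.IsLaxColimit) :
    ∃ (s : T ⟶ S) (r : S ⟶ T), Nonempty (s ≫ r ≅ 𝟙 T) ∧ Nonempty (r ≫ s ≅ 𝟙 S) := by
  have := hc S
  have := hd T
  let e := (c.extend S).objObjPreimageIso d
  let e' := (d.extend T).objObjPreimageIso c
  exact ⟨_, _, hc.exists_iso_id e e', hd.exists_iso_id e' e⟩

end LaxCocone

/-! ### Generic objects of a category -/

section GenericObj

variable {D : Type u} [Category.{v} D] {E : Type u₁} [Category.{v₁} E]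

/-- A subterminal object that receives a morphism from every object it maps to. -/
def IsGenericObj (I : D) : Prop := IsSubterminalObj I ∧ ∀ ⦃X : D⦄, (I ⟶ X) → Nonempty (X ⟶ I)

theorem IsSubterminalObj.of_iso {I I' : D} (h : IsSubterminalObj I) (e : I ≅ I') :
    IsSubterminalObj I' := fun _ p q => by
  rw [← cancel_mono e.inv]; exact h _ _

theorem IsGenericObj.of_iso {I I' : D} (h : IsGenericObj I) (e : I ≅ I') : IsGenericObj I' :=
  ⟨h.1.of_iso e, fun _ p => (h.2 (e.hom ≫ p)).map (· ≫ e.hom)⟩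

/-- A morphism between generic objects is invertible. -/
theorem IsGenericObj.isIso {I X : D} (h : IsGenericObj I) (h' : IsSubterminalObj X) (p : I ⟶ X) :
    IsIso p :=
  ⟨(h.2 p).some, h.1 _ _, h' _ _⟩

theorem IsGenericObj.map_equivalence {I : D} (h : IsGenericObj I)
    (e : CategoryTheory.Equivalence D E) :
    IsGenericObj (e.functor.obj I) := by
  refine ⟨fun X p q => ?_, fun X p => ?_⟩
  · apply e.inverse.map_injective
    rw [← cancel_mono (e.unitInv.app I)]
    exact h.1 _ _
  · obtain ⟨r⟩ := h.2 (e.unit.app I ≫ e.inverse.map p)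
    exact ⟨e.counitInv.app X ≫ e.functor.map r⟩

end GenericObj

section

variable {C : Type u} [Bicategory.{w, v} C]

/-- Liftings through an identity are the generic objects of the hom-category. -/
theorem isStrongMixedLeftLifting_id_iff {a b : C} (f : a ⟶ b) :
    IsStrongMixedLeftLifting f (𝟙 b) f (ρ_ f).inv ↔ IsGenericObj f := by
  refine ⟨fun h => ⟨h.2, fun X p => ?_⟩, fun h => ⟨fun k ψ => ?_, h.1⟩⟩
  · obtain ⟨l, -, -⟩ := h.1 X (p ≫ (ρ_ X).inv)
    exact ⟨l⟩
  -- Genericity gives only the existence of `l`; the triangle and the uniqueness are equalities of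
  -- 2-cells into subterminal objects.
  · obtain ⟨l⟩ := h.2 (ψ ≫ (ρ_ k).hom)
    exact ⟨l, h.1.of_iso (ρ_ f).symm _ _, fun _ _ => h.1 _ _⟩

/-- Strong mixed left liftings are generic. -/
theorem IsStrongMixedLeftLifting.isGenericObj {a b c : C} {f : a ⟶ b} {g : c ⟶ b} {h : a ⟶ c}
    {ν : f ⟶ h ≫ g} (H : IsStrongMixedLeftLifting f g h ν) : IsGenericObj h :=
  ⟨H.2, fun X p => ⟨(H.1 X (ν ≫ p ▷ g)).choose⟩⟩

end

/-! ### Opcartesian morphisms and lax el-generic objects. -/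

namespace El

variable {A : Type u} [Bicategory.{w, v} A] {F : A ⥤ᵖ Cat.{v₁, u₁}} {X Y : El F}

theorem isElGenericMor_iff (f : X ⟶ Y) : IsElGenericMor f ↔ IsGenericObj f :=
  isStrongMixedLeftLifting_id_iff f

theorem isOpcartesian_id (X : El F) : IsOpcartesian (𝟙 X) :=
  inferInstanceAs (IsIso ((F.mapId X.base).hom.toNatTrans.app X.fiber))

theorem IsOpcartesian.comp {Z : El F} {f : X ⟶ Y} {g : Y ⟶ Z} (hf : IsOpcartesian f)
    (hg : IsOpcartesian g) : IsOpcartesian (f ≫ g) := by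
  have : IsIso f.fiber := hf
  have : IsIso g.fiber := hg
  exact inferInstanceAs (IsIso ((F.mapComp f.base g.base).hom.toNatTrans.app X.fiber ≫
    (F.map g.base).toFunctor.map f.fiber ≫ g.fiber))

/-- Opcartesian morphisms out of a lax el-generic object are generic. -/
theorem IsLaxElGeneric.isGenericObj (hX : X.IsLaxElGeneric) {f : X ⟶ Y} (hf : IsOpcartesian f) :
    IsGenericObj f := by
  obtain ⟨h, ν, H, H'⟩ := hX f (𝟙 Y) (isOpcartesian_id Y)
  have := (H' hf).2
  exact H.isGenericObj.of_iso ((ρ_ h).symm ≪≫ (asIso ν).symm)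

/-- An opcartesian morphism between lax el-generic objects has an inverse up to isomorphism. -/
theorem IsLaxElGeneric.exists_inverse (hX : X.IsLaxElGeneric) (hY : Y.IsLaxElGeneric) {e : X ⟶ Y}
    (he : IsOpcartesian e) :
    ∃ r : Y ⟶ X, IsOpcartesian r ∧ Nonempty (e ≫ r ≅ 𝟙 X) ∧ Nonempty (r ≫ e ≅ 𝟙 Y) := by
  obtain ⟨r, ν, -, H⟩ := hY (𝟙 Y) e he
  obtain ⟨hr, hν⟩ := H (isOpcartesian_id Y)
  -- The lifting `l` of `e` through itself serves as a common target: `𝟙 X` and `e ≫ r` both map to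
  -- it. Both are opcartesian, hence generic, and `l` is subterminal, so the two comparisons are
  -- invertible.
  obtain ⟨l, μ, L, L'⟩ := hX e e he
  obtain ⟨hl, hμ⟩ := L' he
  obtain ⟨p, -, -⟩ := L.1 (𝟙 X) (λ_ e).inv
  obtain ⟨q, -, -⟩ := L.1 (e ≫ r) ((ρ_ e).inv ≫ e ◁ ν ≫ (α_ e r e).inv)
  have := (hX.isGenericObj (isOpcartesian_id X)).isIso L.2 p
  have := (hX.isGenericObj (he.comp hr)).isIso L.2 q
  exact ⟨r, hr, ⟨asIso q ≪≫ (asIso p).symm⟩, ⟨(asIso ν).symm⟩⟩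

end El

/-! ### The pointwise lax colimit of representables -/

section Families

variable {A : Type u} [Bicategory.{w, v} A] {J : Type u₁} [Bicategory.{w₂, v₁} J]

/-- Objects of the lax colimit of the categories `A(P j, T)`. -/
structure Family (P : J ⥤ᵖ A) (T : A) where
  idx : J
  leg : P.obj idx ⟶ T

namespace Family

variable {P : J ⥤ᵖ A} {T : A}

/-- A morphism `(j, h) ⟶ (k, h')` is a pair of `p : j ⟶ k` and `h ⟶ P p ≫ h'`. -/
structure Hom (a b : Family P T) where
  base : a.idx ⟶ b.idx
  cell : a.leg ⟶ P.map base ≫ b.leg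

instance categoryStruct : CategoryStruct (Family P T) where
  Hom a b := Hom a b
  id a := ⟨𝟙 a.idx, (λ_ a.leg).inv ≫ (P.mapId a.idx).inv ▷ a.leg⟩
  comp {_ _ c} f g := ⟨f.base ≫ g.base, f.cell ≫ P.map f.base ◁ g.cell ≫
    (α_ _ _ _).inv ≫ (P.mapComp f.base g.base).inv ▷ c.leg⟩

variable [IsLocallyDiscrete J]

/-- Since `J` is locally discrete, `η` forces the bases to be equal. Recording the equality as a
2-cell lets the constraints of `P` replace transport along equalities of 1-cells. -/
theorem hom_ext {a b : Family P T} {f g : a ⟶ b} (η : f.base ⟶ g.base)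
    (h : f.cell ≫ P.map₂ η ▷ b.leg = g.cell) : f = g := by
  obtain ⟨p, ν⟩ := f
  obtain ⟨q, μ⟩ := g
  obtain rfl : p = q := obj_ext_of_isDiscrete η
  obtain rfl : η = 𝟙 p := Subsingleton.elim _ _
  dsimp only at ν μ h
  rw [← h]
  simp

instance category : Category (Family P T) where
  id_comp {a b} f := hom_ext (λ_ f.base).hom (by
    change (((λ_ a.leg).inv ≫ (P.mapId a.idx).inv ▷ a.leg) ≫ P.map (𝟙 a.idx) ◁ f.cell ≫
      (α_ _ _ _).inv ≫ (P.mapComp (𝟙 a.idx) f.base).inv ▷ b.leg) ≫ _ = f.cell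
    rw [P.map₂_left_unitor]
    simp only [Category.assoc]
    rw [← whisker_exchange_assoc]
    simp)
  comp_id {a b} f := hom_ext (ρ_ f.base).hom (by
    change (f.cell ≫ P.map f.base ◁ ((λ_ b.leg).inv ≫ (P.mapId b.idx).inv ▷ b.leg) ≫
      (α_ _ _ _).inv ≫ (P.mapComp f.base (𝟙 b.idx)).inv ▷ b.leg) ≫ _ = f.cell
    rw [P.map₂_right_unitor]
    simp)
  assoc {a b c d} f g h := hom_ext (α_ f.base g.base h.base).hom (by
    change ((f.cell ≫ P.map f.base ◁ g.cell ≫ (α_ _ _ _).inv ≫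
      (P.mapComp f.base g.base).inv ▷ c.leg) ≫ P.map (f.base ≫ g.base) ◁ h.cell ≫ (α_ _ _ _).inv ≫
        (P.mapComp (f.base ≫ g.base) h.base).inv ▷ d.leg) ≫ _ =
      f.cell ≫ P.map f.base ◁ (g.cell ≫ P.map g.base ◁ h.cell ≫ (α_ _ _ _).inv ≫
        (P.mapComp g.base h.base).inv ▷ d.leg) ≫ (α_ _ _ _).inv ≫
          (P.mapComp f.base (g.base ≫ h.base)).inv ▷ d.leg
    rw [P.map₂_associator]
    simp only [Category.assoc, ← whisker_exchange_assoc]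
    simp)

/-- The morphism induced by a 2-cell between legs with the same index. -/
def vert {j : J} {h h' : P.obj j ⟶ T} (ν : h ⟶ h') : (⟨j, h⟩ : Family P T) ⟶ ⟨j, h'⟩ :=
  ⟨𝟙 j, ν ≫ (λ_ h').inv ≫ (P.mapId j).inv ▷ h'⟩

/-- The cartesian morphism over a morphism of the index category. -/
def cart {j k : J} (p : j ⟶ k) (h : P.obj k ⟶ T) : (⟨j, P.map p ≫ h⟩ : Family P T) ⟶ ⟨k, h⟩ :=
  ⟨p, 𝟙 _⟩

/-- This factorization reduces naturality and functoriality statements on families to the two kinds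
of factors. -/
theorem vert_cart {j k : J} {p : j ⟶ k} {h : P.obj k ⟶ T} {h' : P.obj j ⟶ T}
    (ν : h' ⟶ P.map p ≫ h) : vert ν ≫ cart p h = ⟨p, ν⟩ :=
  hom_ext (λ_ p).hom (by
    change ((ν ≫ (λ_ _).inv ≫ (P.mapId j).inv ▷ _) ≫ P.map (𝟙 j) ◁ 𝟙 _ ≫
      (α_ _ _ _).inv ≫ (P.mapComp (𝟙 j) p).inv ▷ h) ≫ P.map₂ (λ_ p).hom ▷ h = ν
    rw [P.map₂_left_unitor]
    simp)

theorem eq_vert_cart {a b : Family P T} (f : a ⟶ b) : f = vert f.cell ≫ cart f.base b.leg :=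
  (vert_cart f.cell).symm

theorem vert_cart_injective {j k : J} {p : j ⟶ k} {h : P.obj k ⟶ T} {h' : P.obj j ⟶ T}
    {ν μ : h' ⟶ P.map p ≫ h} (e : vert ν ≫ cart p h = vert μ ≫ cart p h) : ν = μ := by
  rw [vert_cart, vert_cart] at e
  exact eq_of_heq (Hom.mk.inj e).2

@[simp]
theorem vert_id {j : J} (h : P.obj j ⟶ T) : vert (𝟙 h) = 𝟙 (⟨j, h⟩ : Family P T) :=
  hom_ext (𝟙 _) (by
    change (𝟙 h ≫ (λ_ h).inv ≫ (P.mapId j).inv ▷ h) ≫ P.map₂ (𝟙 _) ▷ h =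
      (λ_ h).inv ≫ (P.mapId j).inv ▷ h
    simp)

theorem vert_comp {j : J} {h h' h'' : P.obj j ⟶ T} (ν : h ⟶ h') (μ : h' ⟶ h'') :
    vert (P := P) (ν ≫ μ) = vert ν ≫ vert μ :=
  Eq.symm <| hom_ext (λ_ _).hom (by
    change ((ν ≫ (λ_ _).inv ≫ (P.mapId j).inv ▷ _) ≫ P.map (𝟙 j) ◁ (μ ≫ (λ_ _).inv ≫
        (P.mapId j).inv ▷ _) ≫ (α_ _ _ _).inv ≫ (P.mapComp (𝟙 j) (𝟙 j)).inv ▷ _) ≫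
          P.map₂ (λ_ (𝟙 j)).hom ▷ h'' =
      (ν ≫ μ) ≫ (λ_ _).inv ≫ (P.mapId j).inv ▷ _
    rw [P.map₂_left_unitor]
    simp only [Category.assoc]
    rw [← whisker_exchange_assoc]
    simp)

theorem vert_comp_assoc {j : J} {h h' h'' : P.obj j ⟶ T} (ν : h ⟶ h') (μ : h' ⟶ h'')
    {a : Family P T} (f : ⟨j, h''⟩ ⟶ a) : vert (ν ≫ μ) ≫ f = vert ν ≫ vert μ ≫ f := by
  rw [vert_comp, Category.assoc]

/-- The isomorphism induced by an isomorphism of legs. -/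
@[simps]
def vertIso {j : J} {h h' : P.obj j ⟶ T} (ν : h ≅ h') : (⟨j, h⟩ : Family P T) ≅ ⟨j, h'⟩ where
  hom := vert ν.hom
  inv := vert ν.inv
  hom_inv_id := by rw [← vert_comp, ν.hom_inv_id, vert_id]
  inv_hom_id := by rw [← vert_comp, ν.inv_hom_id, vert_id]

instance isIso_vert {j : J} {h h' : P.obj j ⟶ T} (ν : h ⟶ h') [IsIso ν] :
    IsIso (vert (P := P) ν) := (vertIso (asIso ν)).isIso_hom

theorem cart_vert {j k : J} (p : j ⟶ k) {h h' : P.obj k ⟶ T} (ν : h ⟶ h') :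
    cart p h ≫ vert ν = vert (P.map p ◁ ν) ≫ cart p h' := by
  rw [vert_cart]
  exact hom_ext (ρ_ p).hom (by
    change (𝟙 _ ≫ P.map p ◁ (ν ≫ (λ_ _).inv ≫ (P.mapId k).inv ▷ _) ≫ (α_ _ _ _).inv ≫
      (P.mapComp p (𝟙 k)).inv ▷ _) ≫ P.map₂ (ρ_ p).hom ▷ h' = P.map p ◁ ν
    rw [P.map₂_right_unitor]
    simp)

/-- With `cart_id` and `cart_map₂`, these are the lax cocone axioms of the universal cocone, read at
an element. -/
theorem cart_comp {j k l : J} (p : j ⟶ k) (q : k ⟶ l) (h : P.obj l ⟶ T) :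
    cart (p ≫ q) h = vert ((P.mapComp p q).hom ▷ h ≫ (α_ _ _ _).hom) ≫
      cart p (P.map q ≫ h) ≫ cart q h := by
  rw [← Category.assoc, vert_cart]
  exact hom_ext (𝟙 _) (by
    change 𝟙 _ ≫ P.map₂ (𝟙 _) ▷ h = ((P.mapComp p q).hom ▷ h ≫ (α_ _ _ _).hom) ≫
      P.map p ◁ 𝟙 _ ≫ (α_ _ _ _).inv ≫ (P.mapComp p q).inv ▷ h
    simp)

theorem cart_id (j : J) (h : P.obj j ⟶ T) :
    cart (𝟙 j) h = vert ((P.mapId j).hom ▷ h ≫ (λ_ h).hom) :=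
  hom_ext (𝟙 _) (by
    change 𝟙 _ ≫ P.map₂ (𝟙 _) ▷ h = ((P.mapId j).hom ▷ h ≫ (λ_ h).hom) ≫ (λ_ h).inv ≫
      (P.mapId j).inv ▷ h
    simp)

theorem cart_map₂ {j k : J} {p q : j ⟶ k} (η : p ⟶ q) (h : P.obj k ⟶ T) :
    vert (P.map₂ η ▷ h) ≫ cart q h = cart p h := by
  rw [vert_cart]
  exact (hom_ext η (Category.id_comp _)).symm

/-- The action on morphisms of the postcomposition of the legs with a fixed 1-cell. -/
def pushMap {S T : A} (g : S ⟶ T) {a b : Family P S} (f : a ⟶ b) :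
    (⟨a.idx, a.leg ≫ g⟩ : Family P T) ⟶ ⟨b.idx, b.leg ≫ g⟩ :=
  ⟨f.base, f.cell ▷ g ≫ (α_ _ _ _).hom⟩

/-- Postcomposition of the legs with a fixed 1-cell. -/
def push {S T : A} (g : S ⟶ T) : Family P S ⥤ Family P T where
  obj a := ⟨a.idx, a.leg ≫ g⟩
  map f := pushMap g f
  map_id a := hom_ext (𝟙 _) (by
    change (((λ_ a.leg).inv ≫ (P.mapId a.idx).inv ▷ a.leg) ▷ g ≫ (α_ _ _ _).hom) ≫
      P.map₂ (𝟙 _) ▷ (a.leg ≫ g) = (λ_ (a.leg ≫ g)).inv ≫ (P.mapId a.idx).inv ▷ (a.leg ≫ g)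
    simp)
  map_comp {a b c} f f' := hom_ext (𝟙 _) (by
    change ((f.cell ≫ P.map f.base ◁ f'.cell ≫ (α_ _ _ _).inv ≫
        (P.mapComp f.base f'.base).inv ▷ c.leg) ▷ g ≫ (α_ _ _ _).hom) ≫
          P.map₂ (𝟙 _) ▷ (c.leg ≫ g) =
      (f.cell ▷ g ≫ (α_ _ _ _).hom) ≫ P.map f.base ◁ (f'.cell ▷ g ≫ (α_ _ _ _).hom) ≫
        (α_ _ _ _).inv ≫ (P.mapComp f.base f'.base).inv ▷ (c.leg ≫ g)
    simp)

theorem pushMap_eq {S T : A} (g : S ⟶ T) {a b : Family P S} (f : a ⟶ b) :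
    pushMap g f = vert (f.cell ▷ g ≫ (α_ _ _ _).hom) ≫ cart f.base (b.leg ≫ g) :=
  (vert_cart _).symm

theorem pushMap_vert {S T : A} (g : S ⟶ T) {j : J} {h h' : P.obj j ⟶ S} (ν : h ⟶ h') :
    pushMap (P := P) g (vert ν) = vert (ν ▷ g) :=
  hom_ext (𝟙 _) (by
    change ((ν ≫ (λ_ h').inv ≫ (P.mapId j).inv ▷ h') ▷ g ≫ (α_ _ _ _).hom) ≫
      P.map₂ (𝟙 _) ▷ (h' ≫ g) = ν ▷ g ≫ (λ_ (h' ≫ g)).inv ≫ (P.mapId j).inv ▷ (h' ≫ g)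
    simp)

theorem pushMap_cart {S T : A} (g : S ⟶ T) {j k : J} (p : j ⟶ k) (h : P.obj k ⟶ S) :
    pushMap g (cart p h) = vert (α_ (P.map p) h g).hom ≫ cart p (h ≫ g) := by
  rw [pushMap_eq]
  change vert (𝟙 _ ▷ g ≫ (α_ _ _ _).hom) ≫ cart p (h ≫ g) = _
  rw [id_whiskerRight, Category.id_comp]

/-- The functors `push` are natural in the 1-cell. -/
def pushTrans {S T : A} {g g' : S ⟶ T} (η : g ⟶ g') : push (P := P) g ⟶ push g' where
  app a := vert (a.leg ◁ η)
  naturality a b f := by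
    have key : (vert (f.cell ▷ g ≫ (α_ _ _ _).hom) ≫ cart f.base (b.leg ≫ g)) ≫ vert (b.leg ◁ η) =
        vert (P := P) (a.leg ◁ η) ≫ vert (f.cell ▷ g' ≫ (α_ _ _ _).hom) ≫
          cart f.base (b.leg ≫ g') := by
      rw [Category.assoc, cart_vert, ← vert_comp_assoc, ← vert_comp_assoc,
        whisker_exchange_assoc]
      simp
    rw [← pushMap_eq, ← pushMap_eq] at key
    exact key

end Family

end Families

/-! ### Pseudonatural transformations between `Cat`-valued pseudofunctors, elementwise -/

namespace CatTrans

variable {A : Type u} [Bicategory.{w, v} A] {G S R : A ⥤ᵖ Cat.{v₂, u₂}}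

/-- The composition constraint of a `Cat`-valued pseudofunctor at an element. -/
def mapCompAt (G : A ⥤ᵖ Cat.{v₂, u₂}) {T T' T'' : A} (f : T ⟶ T') (g : T' ⟶ T'') (x : G.obj T) :
    (G.map (f ≫ g)).toFunctor.obj x ≅ (G.map g).toFunctor.obj ((G.map f).toFunctor.obj x) :=
  (Cat.Hom.toNatIso (G.mapComp f g)).app x

/-- The unit constraint of a `Cat`-valued pseudofunctor at an element. -/
def mapIdAt (G : A ⥤ᵖ Cat.{v₂, u₂}) {T : A} (x : G.obj T) : (G.map (𝟙 T)).toFunctor.obj x ≅ x :=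
  (Cat.Hom.toNatIso (G.mapId T)).app x

/-- The action of a `Cat`-valued pseudofunctor on a 2-cell at an element. -/
def map₂At (G : A ⥤ᵖ Cat.{v₂, u₂}) {T T' : A} {f g : T ⟶ T'} (η : f ⟶ g) (x : G.obj T) :
    (G.map f).toFunctor.obj x ⟶ (G.map g).toFunctor.obj x :=
  (G.map₂ η).toNatTrans.app x

theorem mapCompAt_naturality (G : A ⥤ᵖ Cat.{v₂, u₂}) {T T' T'' : A} (f : T ⟶ T') (g : T' ⟶ T'')
    {x y : G.obj T} (a : x ⟶ y) :
    (G.map (f ≫ g)).toFunctor.map a ≫ (mapCompAt G f g y).hom =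
      (mapCompAt G f g x).hom ≫ (G.map g).toFunctor.map ((G.map f).toFunctor.map a) :=
  (G.mapComp f g).hom.toNatTrans.naturality a

theorem mapIdAt_naturality (G : A ⥤ᵖ Cat.{v₂, u₂}) {T : A} {x y : G.obj T} (a : x ⟶ y) :
    (G.map (𝟙 T)).toFunctor.map a ≫ (mapIdAt G y).hom = (mapIdAt G x).hom ≫ a :=
  (G.mapId T).hom.toNatTrans.naturality a

theorem map₂At_naturality (G : A ⥤ᵖ Cat.{v₂, u₂}) {T T' : A} {f g : T ⟶ T'} (η : f ⟶ g)
    {x y : G.obj T} (a : x ⟶ y) :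
    (G.map f).toFunctor.map a ≫ map₂At G η y = map₂At G η x ≫ (G.map g).toFunctor.map a :=
  (G.map₂ η).toNatTrans.naturality a

/-- The component of a pseudonatural transformation, as a functor. -/
def fn (φ : G ⟶ S) (T : A) : G.obj T ⥤ S.obj T := (φ.app T).toFunctor

/-- The naturality isomorphism of a pseudonatural transformation at an element. -/
def nat (φ : G ⟶ S) {T T' : A} (g : T ⟶ T') (x : G.obj T) :
    (fn φ T').obj ((G.map g).toFunctor.obj x) ≅ (S.map g).toFunctor.obj ((fn φ T).obj x) :=
  (Cat.Hom.toNatIso (φ.naturality g)).app x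

section

variable (φ : G ⟶ S)

theorem nat_naturality {T T' : A} (g : T ⟶ T') {x y : G.obj T} (f : x ⟶ y) :
    (fn φ T').map ((G.map g).toFunctor.map f) ≫ (nat φ g y).hom =
      (nat φ g x).hom ≫ (S.map g).toFunctor.map ((fn φ T).map f) :=
  (Cat.Hom.toNatIso (φ.naturality g)).hom.naturality f

theorem nat_map₂ {T T' : A} {g g' : T ⟶ T'} (η : g ⟶ g') (x : G.obj T) :
    (fn φ T').map (map₂At G η x) ≫ (nat φ g' x).hom =
      (nat φ g x).hom ≫ map₂At S η ((fn φ T).obj x) :=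
  congrArg (fun α => α.toNatTrans.app x) (φ.naturality_naturality η)

theorem nat_id (T : A) (x : G.obj T) :
    (nat φ (𝟙 T) x).hom ≫ (mapIdAt S ((fn φ T).obj x)).hom =
      (fn φ T).map ((mapIdAt G x).hom) :=
  (congrArg (fun α => α.toNatTrans.app x) (φ.naturality_id T)).trans
    ((congrArg _ (Category.comp_id _)).trans (Category.comp_id _))

theorem nat_comp {T T' T'' : A} (f : T ⟶ T') (g : T' ⟶ T'') (x : G.obj T) :
    (nat φ (f ≫ g) x).hom ≫ (mapCompAt S f g ((fn φ T).obj x)).hom =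
      (fn φ T'').map ((mapCompAt G f g x).hom) ≫
        (nat φ g ((G.map f).toFunctor.obj x)).hom ≫ (S.map g).toFunctor.map (nat φ f x).hom := by
  have h := congrArg (fun α => α.toNatTrans.app x) (φ.naturality_comp f g)
  refine h.trans ?_
  have key : ∀ {C : Type u₂} [Category.{v₂} C] {a b c d : C} (p : a ⟶ b) (q : b ⟶ c) (r : c ⟶ d),
      p ≫ 𝟙 _ ≫ q ≫ 𝟙 _ ≫ r ≫ 𝟙 _ = p ≫ q ≫ r := by
    intros; simp
  exact key _ _ _

end

/-- A pseudonatural transformation from elementwise data. -/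
def mk (app : ∀ T, G.obj T ⥤ S.obj T)
    (nat : ∀ {T T' : A} (g : T ⟶ T'), (G.map g).toFunctor ⋙ app T' ≅ app T ⋙ (S.map g).toFunctor)
    (nat_map₂ : ∀ {T T' : A} {g g' : T ⟶ T'} (η : g ⟶ g') (x : G.obj T),
      (app T').map (map₂At G η x) ≫ (nat g').hom.app x =
        (nat g).hom.app x ≫ map₂At S η ((app T).obj x))
    (nat_id : ∀ (T : A) (x : G.obj T),
      (nat (𝟙 T)).hom.app x ≫ (mapIdAt S ((app T).obj x)).hom =
        (app T).map ((mapIdAt G x).hom))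
    (nat_comp : ∀ {T T' T'' : A} (f : T ⟶ T') (g : T' ⟶ T'') (x : G.obj T),
      (nat (f ≫ g)).hom.app x ≫ (mapCompAt S f g ((app T).obj x)).hom =
        (app T'').map ((mapCompAt G f g x).hom) ≫
          (nat g).hom.app ((G.map f).toFunctor.obj x) ≫
            (S.map g).toFunctor.map ((nat f).hom.app x)) : G ⟶ S where
  app T := (app T).toCatHom
  naturality g := Cat.Hom.isoMk (nat g)
  naturality_naturality η := cat_ext fun x => nat_map₂ η x
  naturality_id T := cat_ext fun x => (nat_id T x).trans
    ((congrArg _ (Category.comp_id _)).trans (Category.comp_id _)).symm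
  naturality_comp {T T' T''} f g := cat_ext fun x => by
    have key : ∀ {C : Type u₂} [Category.{v₂} C] {a b c d : C} (p : a ⟶ b) (q : b ⟶ c)
        (r : c ⟶ d), p ≫ q ≫ r = p ≫ 𝟙 _ ≫ q ≫ 𝟙 _ ≫ r ≫ 𝟙 _ := by
      intros; simp
    exact (nat_comp f g x).trans (key _ _ _)

/-- The component of a modification at an element. -/
def at_ {φ ψ : G ⟶ S} (Γ : φ ⟶ ψ) (T : A) (x : G.obj T) : (fn φ T).obj x ⟶ (fn ψ T).obj x :=
  (Γ.as.app T).toNatTrans.app x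

theorem at_naturality {φ ψ : G ⟶ S} (Γ : φ ⟶ ψ) {T : A} {x y : G.obj T} (f : x ⟶ y) :
    (fn φ T).map f ≫ at_ Γ T y = at_ Γ T x ≫ (fn ψ T).map f :=
  (Γ.as.app T).toNatTrans.naturality f

theorem at_nat {φ ψ : G ⟶ S} (Γ : φ ⟶ ψ) {T T' : A} (g : T ⟶ T') (x : G.obj T) :
    at_ Γ T' ((G.map g).toFunctor.obj x) ≫ (nat ψ g x).hom =
      (nat φ g x).hom ≫ (S.map g).toFunctor.map (at_ Γ T x) :=
  congrArg (fun α => α.toNatTrans.app x) (Γ.as.naturality g)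

theorem mod_ext {φ ψ : G ⟶ S} {Γ Γ' : φ ⟶ ψ} (h : ∀ T x, at_ Γ T x = at_ Γ' T x) : Γ = Γ' :=
  Pseudofunctor.StrongTrans.homCategory.ext fun T => cat_ext fun x => h T x

/-- A modification from elementwise data. -/
def modMk {φ ψ : G ⟶ S} (app : ∀ T, fn φ T ⟶ fn ψ T)
    (h : ∀ {T T' : A} (g : T ⟶ T') (x : G.obj T),
      (app T').app ((G.map g).toFunctor.obj x) ≫ (nat ψ g x).hom =
        (nat φ g x).hom ≫ (S.map g).toFunctor.map ((app T).app x)) : φ ⟶ ψ where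
  as := {
    app T := ⟨app T⟩
    naturality g := cat_ext fun x => h g x }

/-- An invertible modification from elementwise data. -/
def modIsoMk {φ ψ : G ⟶ S} (app : ∀ T, fn φ T ≅ fn ψ T)
    (h : ∀ {T T' : A} (g : T ⟶ T') (x : G.obj T),
      (app T').hom.app ((G.map g).toFunctor.obj x) ≫ (nat ψ g x).hom =
        (nat φ g x).hom ≫ (S.map g).toFunctor.map ((app T).hom.app x)) : φ ≅ ψ :=
  Pseudofunctor.StrongTrans.isoMk (fun T => Cat.Hom.isoMk (app T))
    (fun g => cat_ext fun x => h g x)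

/-- The associators of `Cat` have identity components, so only the two naturality isomorphisms
remain. -/
theorem nat_comp_trans_hom (φ : G ⟶ S) (ψ : S ⟶ R) {T T' : A} (g : T ⟶ T') (x : G.obj T) :
    (nat (φ ≫ ψ) g x).hom = (fn ψ T').map (nat φ g x).hom ≫ (nat ψ g ((fn φ T).obj x)).hom := by
  have key : ∀ {C : Type u₂} [Category.{v₂} C] {a b c : C} (p : a ⟶ b) (q : b ⟶ c),
      𝟙 _ ≫ p ≫ 𝟙 _ ≫ q ≫ 𝟙 _ = p ≫ q := by
    intros; simp
  exact key _ _

theorem nat_id_trans_hom {T T' : A} (g : T ⟶ T') (x : G.obj T) :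
    (nat (𝟙 G) g x).hom = 𝟙 _ :=
  Category.comp_id _

/-! #### Components of an invertible modification -/

@[simp]
theorem at_hom_inv {φ ψ : G ⟶ S} (e : φ ≅ ψ) (T : A) (x : G.obj T) :
    at_ e.hom T x ≫ at_ e.inv T x = 𝟙 _ :=
  congrArg (fun Γ => at_ Γ T x) e.hom_inv_id

@[simp]
theorem at_inv_hom {φ ψ : G ⟶ S} (e : φ ≅ ψ) (T : A) (x : G.obj T) :
    at_ e.inv T x ≫ at_ e.hom T x = 𝟙 _ :=
  congrArg (fun Γ => at_ Γ T x) e.inv_hom_id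

/-- The natural isomorphism underlying an invertible modification. -/
def fnIso {φ ψ : G ⟶ S} (e : φ ≅ ψ) (T : A) : fn φ T ≅ fn ψ T :=
  NatIso.ofComponents (fun x => ⟨at_ e.hom T x, at_ e.inv T x, by simp, by simp⟩)
    (fun f => at_naturality e.hom f)

theorem isEquivalence_fn {φ : G ⟶ S} {ψ : S ⟶ G} (e : φ ≫ ψ ≅ 𝟙 G) (e' : ψ ≫ φ ≅ 𝟙 S) (T : A) :
    (fn φ T).IsEquivalence :=
  (CategoryTheory.Equivalence.mk (fn φ T) (fn ψ T) (fnIso e T).symm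
    (fnIso e' T)).isEquivalence_functor

/-! #### Pointwise equivalences have inverses -/

section Inverse

variable (φ : G ⟶ S) [∀ T, (fn φ T).IsEquivalence]

/-- The chosen preimage of an element under a pointwise equivalence. -/
noncomputable def pre {T : A} (y : S.obj T) : G.obj T := (fn φ T).objPreimage y

/-- The image of the chosen preimage. -/
noncomputable def preIso {T : A} (y : S.obj T) : (fn φ T).obj (pre φ y) ≅ y :=
  (fn φ T).objObjPreimageIso y

/-- The chosen preimage of a morphism under a pointwise equivalence. -/
noncomputable def preMap {T : A} {x y : S.obj T} (f : x ⟶ y) : pre φ x ⟶ pre φ y :=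
  (fn φ T).preimage ((preIso φ x).hom ≫ f ≫ (preIso φ y).inv)

theorem fn_preMap {T : A} {x y : S.obj T} (f : x ⟶ y) :
    (fn φ T).map (preMap φ f) = (preIso φ x).hom ≫ f ≫ (preIso φ y).inv :=
  (fn φ T).map_preimage _

/-- The components of the inverse transformation. -/
noncomputable def invFn (T : A) : S.obj T ⥤ G.obj T where
  obj := pre φ
  map := preMap φ
  map_id x := (fn φ T).map_injective (by simp [fn_preMap])
  map_comp f g := (fn φ T).map_injective (by simp [fn_preMap])

/-- The naturality isomorphisms of the inverse transformation. -/
noncomputable def invNat {T T' : A} (g : T ⟶ T') (y : S.obj T) :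
    pre φ ((S.map g).toFunctor.obj y) ≅ (G.map g).toFunctor.obj (pre φ y) :=
  (fn φ T').preimageIso (preIso φ _ ≪≫ (S.map g).toFunctor.mapIso (preIso φ y).symm ≪≫
    (nat φ g (pre φ y)).symm)

theorem fn_invNat {T T' : A} (g : T ⟶ T') (y : S.obj T) :
    (fn φ T').map (invNat φ g y).hom = (preIso φ ((S.map g).toFunctor.obj y)).hom ≫
      (S.map g).toFunctor.map (preIso φ y).inv ≫ (nat φ g (pre φ y)).inv :=
  (fn φ T').map_preimage _

/-- The inverse of a pointwise equivalence. -/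
noncomputable def inverse : S ⟶ G :=
  mk (invFn φ) (fun {T T'} g => NatIso.ofComponents (fun y => invNat φ g y) (fun {x y} f => by
      -- As in the coherence axioms below, the equation is tested after applying the faithful
      -- functor `fn φ T'`, where the chosen preimages become explicit composites.
      apply (fn φ T').map_injective
      have h := nat_naturality φ g (preMap φ f)
      rw [fn_preMap] at h
      change (fn φ T').map (preMap φ ((S.map g).toFunctor.map f) ≫ (invNat φ g y).hom) =
        (fn φ T').map ((invNat φ g x).hom ≫ (G.map g).toFunctor.map (preMap φ f))
      rw [Functor.map_comp, Functor.map_comp, fn_invNat, fn_invNat, fn_preMap,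
        ← cancel_mono (nat φ g (pre φ y)).hom]
      simp only [Category.assoc, Iso.inv_hom_id, Category.comp_id, Iso.inv_hom_id_assoc]
      rw [h]
      simp))
    (fun {T T' g g'} η y => by
      apply (fn φ T').map_injective
      change (fn φ T').map (preMap φ (map₂At S η y) ≫
        (invNat φ g' y).hom) = (fn φ T').map ((invNat φ g y).hom ≫
          map₂At G η (pre φ y))
      rw [Functor.map_comp, Functor.map_comp, fn_invNat, fn_invNat, fn_preMap,
        ← cancel_mono (nat φ g' (pre φ y)).hom]
      simp [nat_map₂, map₂At_naturality])
    (fun T y => by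
      apply (fn φ T).map_injective
      change (fn φ T).map ((invNat φ (𝟙 T) y).hom ≫ (mapIdAt G (pre φ y)).hom) =
        (fn φ T).map (preMap φ ((mapIdAt S y).hom))
      rw [Functor.map_comp, fn_invNat, fn_preMap, ← nat_id]
      simp [mapIdAt_naturality])
    (fun {T T' T''} f g y => by
      apply (fn φ T'').map_injective
      change (fn φ T'').map ((invNat φ (f ≫ g) y).hom ≫
          (mapCompAt G f g (pre φ y)).hom) =
        (fn φ T'').map (preMap φ ((mapCompAt S f g y).hom) ≫
          (invNat φ g ((S.map f).toFunctor.obj y)).hom ≫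
            (G.map g).toFunctor.map (invNat φ f y).hom)
      have h := nat_naturality φ g (invNat φ f y).hom
      have h' := nat_comp φ f g (pre φ y)
      simp only [Functor.map_comp]
      rw [← cancel_mono (nat φ g ((G.map f).toFunctor.obj (pre φ y))).hom,
        ← cancel_mono ((S.map g).toFunctor.map (nat φ f (pre φ y)).hom)]
      simp only [Category.assoc]
      rw [← h', reassoc_of% h, fn_invNat, fn_invNat, fn_preMap, fn_invNat]
      simp [← mapCompAt_naturality])

/-- A pointwise equivalence is an equivalence in the bicategory of pseudofunctors. -/
noncomputable def inverseCompIso : inverse φ ≫ φ ≅ 𝟙 S :=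
  modIsoMk (fun T => NatIso.ofComponents (fun y => preIso φ y) (fun {x y} f => by
      change (fn φ T).map (preMap φ f) ≫ (preIso φ y).hom = (preIso φ x).hom ≫ f
      rw [fn_preMap]; simp))
    (fun {T T'} g y => by
      rw [nat_id_trans_hom, nat_comp_trans_hom]
      change (preIso φ _).hom ≫ 𝟙 _ = ((fn φ T').map (invNat φ g y).hom ≫
        (nat φ g (pre φ y)).hom) ≫ (S.map g).toFunctor.map (preIso φ y).hom
      rw [fn_invNat]
      simp [← Functor.map_comp])

/-- A pointwise equivalence composed with its inverse is isomorphic to the identity. -/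
noncomputable def compInverseIso : φ ≫ inverse φ ≅ 𝟙 G :=
  modIsoMk (fun T => NatIso.ofComponents
      (fun x => (fn φ T).preimageIso (preIso φ ((fn φ T).obj x)))
      (fun {x y} f => (fn φ T).map_injective (by
        change (fn φ T).map (preMap φ ((fn φ T).map f) ≫ (fn φ T).preimage _) =
          (fn φ T).map ((fn φ T).preimage _ ≫ f)
        rw [Functor.map_comp, Functor.map_comp, fn_preMap, Functor.map_preimage,
          Functor.map_preimage]
        simp)))
    (fun {T T'} g x => (fn φ T').map_injective (by
      rw [nat_id_trans_hom, nat_comp_trans_hom]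
      change (fn φ T').map ((fn φ T').preimage (preIso φ _).hom ≫ 𝟙 _) =
        (fn φ T').map ((preMap φ (nat φ g x).hom ≫ (invNat φ g ((fn φ T).obj x)).hom) ≫
          (G.map g).toFunctor.map ((fn φ T).preimage (preIso φ ((fn φ T).obj x)).hom))
      have h := nat_naturality φ g ((fn φ T).preimage (preIso φ ((fn φ T).obj x)).hom)
      rw [← cancel_mono (nat φ g x).hom, Functor.map_comp, Functor.map_comp, Functor.map_comp,
        Category.assoc, Category.assoc, h, fn_preMap, fn_invNat, Functor.map_preimage,
        Functor.map_preimage]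
      simp [← Functor.map_comp]))

end Inverse

end CatTrans

/-! ### Families as a pseudofunctor of the vertex. -/

section

variable {A : Type u} [Bicategory.{w, v} A] {J : Type u₁} [Bicategory.{w₂, v₁} J]
  [IsLocallyDiscrete J] (P : J ⥤ᵖ A)

open Family in
/-- The pointwise lax colimit of representables, as a pseudofunctor. -/
def families : A ⥤ᵖ Cat.{max v₁ w, max u₁ v} where
  obj T := Cat.of (Family P T)
  map g := (push g).toCatHom
  map₂ η := (pushTrans η).toCatHom₂
  map₂_id f := cat_ext fun (a : Family P _) => by
    have key : vert (P := P) (a.leg ◁ 𝟙 f) = 𝟙 _ := by rw [whiskerLeft_id, vert_id]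
    exact key
  map₂_comp η θ := cat_ext fun (a : Family P _) => by
    have key : vert (P := P) (a.leg ◁ (η ≫ θ)) = vert (a.leg ◁ η) ≫ vert (a.leg ◁ θ) := by
      rw [whiskerLeft_comp, vert_comp]
    exact key
  mapId T := Cat.Hom.isoMk (NatIso.ofComponents (fun a => vertIso (ρ_ a.leg)) (fun {a b} f => by
    have key : (vert (f.cell ▷ 𝟙 T ≫ (α_ _ _ _).hom) ≫ cart f.base (b.leg ≫ 𝟙 T)) ≫
        vert (ρ_ b.leg).hom = vert (P := P) (ρ_ a.leg).hom ≫ vert f.cell ≫ cart f.base b.leg := by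
      rw [Category.assoc, cart_vert, ← vert_comp_assoc, ← vert_comp_assoc]
      simp
    rw [vert_cart, vert_cart] at key
    exact key) : push (𝟙 T) ≅ 𝟭 (Family P T))
  mapComp f g := Cat.Hom.isoMk (NatIso.ofComponents (fun a => vertIso (α_ a.leg f g).symm)
    (fun {a b} k => by
      have key : (vert (k.cell ▷ (f ≫ g) ≫ (α_ _ _ _).hom) ≫ cart k.base (b.leg ≫ f ≫ g)) ≫
          vert (α_ b.leg f g).inv = vert (P := P) (α_ a.leg f g).inv ≫
            vert ((k.cell ▷ f ≫ (α_ _ _ _).hom) ▷ g ≫ (α_ _ _ _).hom) ≫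
              cart k.base ((b.leg ≫ f) ≫ g) := by
        rw [Category.assoc, cart_vert, ← vert_comp_assoc, ← vert_comp_assoc]
        simp
      rw [vert_cart, vert_cart] at key
      exact key) : push (f ≫ g) ≅ push f ⋙ push (P := P) g)
  map₂_whisker_left f g h η := cat_ext fun (a : Family P _) => by
    have key : vert (P := P) (a.leg ◁ f ◁ η) =
        vert (α_ a.leg f g).inv ≫ vert ((a.leg ≫ f) ◁ η) ≫ vert (α_ a.leg f h).hom := by
      rw [← vert_comp, ← vert_comp]; simp
    exact key
  map₂_whisker_right {_ _ _ f g} η h := cat_ext fun (a : Family P _) => by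
    have key : vert (P := P) (a.leg ◁ η ▷ h) =
        vert (α_ a.leg f h).inv ≫ vert ((a.leg ◁ η) ▷ h) ≫
          vert (α_ a.leg g h).hom := by
      rw [← vert_comp, ← vert_comp]; simp
    rw [← pushMap_vert] at key
    exact key
  map₂_associator f g h := cat_ext fun (a : Family P _) => by
    have key : vert (P := P) (a.leg ◁ (α_ f g h).hom) = vert (α_ a.leg (f ≫ g) h).inv ≫
        vert ((α_ a.leg f g).inv ▷ h) ≫
          𝟙 _ ≫ vert (α_ (a.leg ≫ f) g h).hom ≫ vert (α_ a.leg f (g ≫ h)).hom := by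
      rw [Category.id_comp, ← vert_comp, ← vert_comp, ← vert_comp]; simp
    rw [← pushMap_vert] at key
    exact key
  map₂_left_unitor f := cat_ext fun (a : Family P _) => by
    have key : vert (P := P) (a.leg ◁ (λ_ f).hom) =
        vert (α_ a.leg _ f).inv ≫ vert ((ρ_ a.leg).hom ▷ f) ≫ 𝟙 _ := by
      rw [Category.comp_id, ← vert_comp]; simp
    rw [← pushMap_vert] at key
    exact key
  map₂_right_unitor f := cat_ext fun (a : Family P _) => by
    have key : vert (P := P) (a.leg ◁ (ρ_ f).hom) =
        vert (α_ a.leg f _).inv ≫ vert (ρ_ (a.leg ≫ f)).hom ≫ 𝟙 _ := by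
      rw [Category.comp_id, ← vert_comp]; simp
    exact key

end

/-! ### Pseudonatural transformations out of representables -/

namespace CatTrans

variable {A : Type u} [Bicategory.{w, v} A] {X : A} {S : A ⥤ᵖ Cat.{max t w v, max t w v}}
  (φ : smallCorep.{t} X ⟶ S)

/-- The value of a transformation out of a representable at a 1-cell. -/
def ev {T : A} (h : X ⟶ T) : S.obj T := (fn φ T).obj (AsSmall.up.obj h)

/-- The value of a transformation out of a representable at a 2-cell. -/
def evMap {T : A} {h h' : X ⟶ T} (ν : h ⟶ h') : ev φ h ⟶ ev φ h' :=
  (fn φ T).map (AsSmall.up.map ν)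

/-- The naturality isomorphism of a transformation out of a representable at a 1-cell. -/
def evNat {T T' : A} (h : X ⟶ T) (g : T ⟶ T') :
    ev φ (h ≫ g) ≅ (S.map g).toFunctor.obj (ev φ h) :=
  nat φ g (AsSmall.up.obj h)

@[simp]
theorem evMap_id {T : A} (h : X ⟶ T) : evMap φ (𝟙 h) = 𝟙 _ :=
  (fn φ T).map_id _

theorem evMap_comp {T : A} {h h' h'' : X ⟶ T} (ν : h ⟶ h') (μ : h' ⟶ h'') :
    evMap φ (ν ≫ μ) = evMap φ ν ≫ evMap φ μ :=
  (fn φ T).map_comp (AsSmall.up.map ν) (AsSmall.up.map μ)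

theorem evMap_comp_assoc {T : A} {h h' h'' : X ⟶ T} (ν : h ⟶ h') (μ : h' ⟶ h'') {y : S.obj T}
    (f : ev φ h'' ⟶ y) : evMap φ (ν ≫ μ) ≫ f = evMap φ ν ≫ evMap φ μ ≫ f := by
  rw [evMap_comp, Category.assoc]

theorem evNat_naturality {T T' : A} {h h' : X ⟶ T} (ν : h ⟶ h') (g : T ⟶ T') :
    evMap φ (ν ▷ g) ≫ (evNat φ h' g).hom =
      (evNat φ h g).hom ≫ (S.map g).toFunctor.map (evMap φ ν) :=
  nat_naturality φ g (AsSmall.up.map ν)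

theorem evNat_naturality_assoc {T T' : A} {h h' : X ⟶ T} (ν : h ⟶ h') (g : T ⟶ T') {y : S.obj T'}
    (f : (S.map g).toFunctor.obj (ev φ h') ⟶ y) : evMap φ (ν ▷ g) ≫ (evNat φ h' g).hom ≫ f =
      (evNat φ h g).hom ≫ (S.map g).toFunctor.map (evMap φ ν) ≫ f := by
  rw [← Category.assoc, evNat_naturality, Category.assoc]

theorem evNat_map₂ {T T' : A} (h : X ⟶ T) {g g' : T ⟶ T'} (η : g ⟶ g') :
    evMap φ (h ◁ η) ≫ (evNat φ h g').hom = (evNat φ h g).hom ≫ map₂At S η (ev φ h) :=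
  nat_map₂ φ η (AsSmall.up.obj h)

theorem evNat_id {T : A} (h : X ⟶ T) :
    (evNat φ h (𝟙 T)).hom ≫ (mapIdAt S (ev φ h)).hom = evMap φ (ρ_ h).hom :=
  (nat_id φ T (AsSmall.up.obj h)).trans
    (congrArg (fn φ T).map (small_hom_ext (Category.comp_id _)))

theorem evNat_comp {T T' T'' : A} (h : X ⟶ T) (f : T ⟶ T') (g : T' ⟶ T'') :
    (evNat φ h (f ≫ g)).hom ≫ (mapCompAt S f g (ev φ h)).hom =
      evMap φ (α_ h f g).inv ≫ (evNat φ (h ≫ f) g).hom ≫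
        (S.map g).toFunctor.map (evNat φ h f).hom :=
  (nat_comp φ f g (AsSmall.up.obj h)).trans
    (congrArg (· ≫ _) (congrArg (fn φ T'').map (small_hom_ext (Category.comp_id _))))

end CatTrans

/-! ### Lax cocones under representables -/

section Cocone

open CatTrans

variable {A : Type u} [Bicategory.{w, v} A] {J : Type (max t w v)} [Bicategory.{w₂, max t w v} J]
  {P : J ⥤ᵖ A} {S : A ⥤ᵖ Cat.{max t w v, max t w v}}

/-- Lax cocones under the diagram of representables of `P`. -/
abbrev ReprCocone (P : J ⥤ᵖ A) (S : A ⥤ᵖ Cat.{max t w v, max t w v}) :=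
  LaxCocone ((opPseudofunctor P).comp smallCoyoneda.{t}) S

namespace ReprCocone

variable (d : ReprCocone.{t} P S)

/-- The legs of a lax cocone under representables. -/
def leg (j : J) : smallCorep.{t} (P.obj j) ⟶ S := d.ι (op j)

/-- The cells of a lax cocone under representables at an element. -/
def cellAt {j k : J} (p : j ⟶ k) {T : A} (h : P.obj k ⟶ T) :
    ev (d.leg j) (P.map p ≫ h) ⟶ ev (d.leg k) h :=
  at_ (d.cell p.op) T (AsSmall.up.obj h)

theorem cellAt_naturality {j k : J} (p : j ⟶ k) {T : A} {h h' : P.obj k ⟶ T} (ν : h ⟶ h') :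
    evMap (d.leg j) (P.map p ◁ ν) ≫ d.cellAt p h' = d.cellAt p h ≫ evMap (d.leg k) ν :=
  at_naturality (d.cell p.op) (AsSmall.up.map ν)

theorem cellAt_id (j : J) {T : A} (h : P.obj j ⟶ T) :
    d.cellAt (𝟙 j) h = evMap (d.leg j) ((P.mapId j).hom ▷ h ≫ (λ_ h).hom) :=
  (congrArg (fun Γ => at_ Γ T (AsSmall.up.obj h)) (d.cell_id (op j))).trans (Category.comp_id _)

theorem cellAt_comp {j k l : J} (p : j ⟶ k) (q : k ⟶ l) {T : A} (h : P.obj l ⟶ T) :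
    d.cellAt (p ≫ q) h = evMap (d.leg j) ((P.mapComp p q).hom ▷ h ≫ (α_ _ _ _).hom) ≫
      d.cellAt p (P.map q ≫ h) ≫ d.cellAt q h :=
  (congrArg (fun Γ => at_ Γ T (AsSmall.up.obj h)) (d.cell_comp q.op p.op)).trans
    (congrArg (_ ≫ ·) (Category.id_comp _))

theorem cellAt_nat {j k : J} (p : j ⟶ k) {T T' : A} (h : P.obj k ⟶ T) (g : T ⟶ T') :
    d.cellAt p (h ≫ g) ≫ (evNat (d.leg k) h g).hom =
      evMap (d.leg j) (α_ _ _ _).inv ≫ (evNat (d.leg j) (P.map p ≫ h) g).hom ≫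
        (S.map g).toFunctor.map (d.cellAt p h) := by
  refine (at_nat (d.cell p.op) g (AsSmall.up.obj h)).trans ?_
  rw [← Category.assoc]
  exact congrArg (· ≫ _) (nat_comp_trans_hom _ _ _ _)

end ReprCocone

variable [IsLocallyDiscrete J]

namespace ReprCocone

variable (d : ReprCocone.{t} P S)

/-- The comparison functor out of the pointwise lax colimit. -/
def descFn (T : A) : Family P T ⥤ S.obj T where
  obj a := ev (d.leg a.idx) a.leg
  map {_ b} f := evMap (d.leg _) f.cell ≫ d.cellAt f.base b.leg
  map_id a := by
    change evMap (d.leg a.idx) ((λ_ a.leg).inv ≫ (P.mapId a.idx).inv ▷ a.leg) ≫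
      d.cellAt (𝟙 a.idx) a.leg = _
    rw [cellAt_id, ← evMap_comp]
    simp
  map_comp {a b c} f g := by
    change evMap (d.leg a.idx) (f.cell ≫ P.map f.base ◁ g.cell ≫ (α_ _ _ _).inv ≫
      (P.mapComp f.base g.base).inv ▷ c.leg) ≫ d.cellAt (f.base ≫ g.base) c.leg = _
    have h := d.cellAt_naturality f.base g.cell
    simp only [Category.assoc]
    rw [cellAt_comp, ← evMap_comp_assoc, ← reassoc_of% h, ← evMap_comp_assoc]
    simp

theorem descFn_vert {T : A} {j : J} {h h' : P.obj j ⟶ T} (ν : h ⟶ h') :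
    (d.descFn T).map (Family.vert ν) = evMap (d.leg j) ν := by
  change evMap (d.leg j) (ν ≫ (λ_ h').inv ≫ (P.mapId j).inv ▷ h') ≫ d.cellAt (𝟙 j) h' = _
  rw [cellAt_id, ← evMap_comp]
  simp

theorem descFn_cart {T : A} {j k : J} (p : j ⟶ k) (h : P.obj k ⟶ T) :
    (d.descFn T).map (Family.cart p h) = d.cellAt p h := by
  change evMap (d.leg j) (𝟙 _) ≫ d.cellAt p h = _
  rw [evMap_id, Category.id_comp]

/-- The comparison transformation out of the pointwise lax colimit. -/
def desc : families P ⟶ S :=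
  CatTrans.mk d.descFn
    (fun {T T'} g => NatIso.ofComponents (fun a => evNat (d.leg a.idx) a.leg g) (fun {a b} f => by
      change (evMap (d.leg a.idx) (f.cell ▷ g ≫ (α_ _ _ _).hom) ≫
          d.cellAt f.base (b.leg ≫ g)) ≫ (evNat (d.leg b.idx) b.leg g).hom =
        (evNat (d.leg a.idx) a.leg g).hom ≫ (S.map g).toFunctor.map
          (evMap (d.leg a.idx) f.cell ≫ d.cellAt f.base b.leg)
      rw [Category.assoc, cellAt_nat, ← evMap_comp_assoc, Category.assoc, Iso.hom_inv_id,
        Category.comp_id, evNat_naturality_assoc, Functor.map_comp]))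
    (fun {T T' g g'} η a => by
      refine Eq.trans ?_ (evNat_map₂ (d.leg a.idx) a.leg η)
      exact congrArg (· ≫ _) (d.descFn_vert _))
    (fun T a => (evNat_id (d.leg a.idx) a.leg).trans (d.descFn_vert _).symm)
    (fun {T T' T''} f g a => by
      refine (evNat_comp (d.leg a.idx) a.leg f g).trans ?_
      exact congrArg (· ≫ _) (d.descFn_vert _).symm)

end ReprCocone

variable (P)

/-- The inclusion of a representable into the pointwise lax colimit. -/
def familiesLeg (j : J) : smallCorep.{t} (P.obj j) ⟶ families P :=
  CatTrans.mk
    (fun T => {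
      obj h := ⟨j, AsSmall.down.obj h⟩
      map ν := Family.vert ν.down
      map_id h := Family.vert_id _
      map_comp ν μ := Family.vert_comp ν.down μ.down })
    (fun {T T'} g => NatIso.ofComponents (fun h => Iso.refl _) (fun {h h'} ν => by
      refine (Category.comp_id _).trans (Eq.trans ?_ (Category.id_comp _).symm)
      exact (Family.pushMap_vert g ν.down).symm))
    (fun η h => (Category.comp_id _).trans (Category.id_comp _).symm)
    (fun T h => (Category.id_comp _).trans (congrArg Family.vert (Category.comp_id _)).symm)
    (fun {T T' T''} f g h => by
      have key : ∀ h : P.obj j ⟶ T, 𝟙 _ ≫ Family.vert (P := P) (α_ h f g).inv =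
          Family.vert ((α_ h f g).inv ≫ 𝟙 _) ≫ 𝟙 _ ≫ (Family.push g).map (𝟙 ⟨j, h ≫ f⟩) := by
        intro h
        have e : 𝟙 _ ≫ Family.vert (P := P) (α_ h f g).inv =
            Family.vert ((α_ h f g).inv ≫ 𝟙 _) ≫ 𝟙 _ ≫ 𝟙 _ := by simp
        exact e.trans (congrArg (fun x => _ ≫ _ ≫ x)
          (CategoryTheory.Functor.map_id (Family.push g) ⟨j, h ≫ f⟩).symm)
      exact key (AsSmall.down.obj h))

/-- The lax cocone with vertex the pointwise lax colimit. -/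
def familiesCocone : ReprCocone.{t} P (families P) where
  ι j := familiesLeg P j.unop
  cell {j k} p := modMk
    (fun T => {
      app h := Family.cart p.unop (AsSmall.down.obj h)
      naturality h h' ν := (Family.cart_vert p.unop ν.down).symm })
    (fun {T T'} g h => by
      refine (Category.comp_id _).trans
        (Eq.trans ?_ (congrArg (· ≫ _)
          (nat_comp_trans_hom (smallCorepMap.{t} (P.map p.unop)) (familiesLeg P k.unop) g h).symm))
      have key : ∀ h : P.obj j.unop ⟶ T, Family.cart p.unop (h ≫ g) =
          (Family.vert (P := P) (α_ (P.map p.unop) h g).inv ≫ 𝟙 _) ≫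
            (Family.push g).map (Family.cart p.unop h) := by
        intro h
        rw [Category.comp_id]
        refine Eq.trans ?_ (congrArg (_ ≫ ·) (Family.pushMap_cart g p.unop h).symm)
        rw [← Family.vert_comp_assoc]
        simp
      exact key (AsSmall.down.obj h))
  cell_naturality {a b f g} η := mod_ext fun T h =>
    Family.cart_map₂ (P := P) η.unop2 (AsSmall.down.obj h)
  cell_id a := mod_ext fun T h =>
    (Family.cart_id a.unop (AsSmall.down.obj h)).trans (Category.comp_id _).symm
  cell_comp {a b c} f g := mod_ext fun T h =>
    (Family.cart_comp g.unop f.unop (AsSmall.down.obj h)).trans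
      (congrArg (_ ≫ ·) (Category.id_comp _).symm)

variable {P}

/-- The legs into the families have identity naturality constraints, so composing with them does not
alter the constraint of `s`. -/
theorem nat_familiesLeg_comp (s : families P ⟶ S) (j : J) {T T' : A} (g : T ⟶ T')
    (h : P.obj j ⟶ T) :
    (nat (familiesLeg.{t} P j ≫ s) g (AsSmall.up.obj h)).hom =
      (nat s g (⟨j, h⟩ : Family P T)).hom := by
  refine (nat_comp_trans_hom _ _ _ _).trans ?_
  refine (congrArg (· ≫ _) ((fn s T').map_id _)).trans ?_
  exact Category.id_comp _

variable (P)

/-- An object `(j, h)` of the families is the value of leg `j` at `h`, so modifications out of the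
families are determined by their restrictions to the legs. Conversely, a morphism of cocones is
natural on `vert` because its components are modifications and on `cart` by its own axiom. Every
cocone is induced, up to isomorphism, by `desc`. -/
theorem familiesCocone_isLaxColimit : (familiesCocone.{t} P).IsLaxColimit := fun S => by
  refine { faithful := ⟨fun {s s' η θ} e => ?_⟩, full := ⟨fun {s s'} θ => ?_⟩,
           essSurj := ⟨fun d => ?_⟩ }
  · refine mod_ext fun T a => ?_
    exact congrArg (fun Γ => at_ (LaxCocone.Hom.app Γ (op a.idx)) T (AsSmall.up.obj a.leg)) e
  · refine ⟨modMk (fun T => {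
      app a := at_ (θ.app (op a.idx)) T (AsSmall.up.obj a.leg)
      naturality := fun (a b : Family P T) f => ?_ }) (fun {T T'} g (a : Family P T) => ?_), ?_⟩
    · let τ (c : Family P T) : (fn s T).obj c ⟶ (fn s' T).obj c :=
        at_ (θ.app (op c.idx)) T (AsSmall.up.obj c.leg)
      -- The squares for the vertical and the cartesian factor of `f`; pasting them gives the square
      -- for `f`.
      have h₁ : (fn s T).map (Family.vert f.cell) ≫ τ ⟨a.idx, P.map f.base ≫ b.leg⟩ =
          τ a ≫ (fn s' T).map (Family.vert f.cell) :=
        at_naturality (θ.app (op a.idx)) (T := T) (AsSmall.up.map f.cell)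
      have h₂ : τ ⟨a.idx, P.map f.base ≫ b.leg⟩ ≫ 𝟙 _ ≫ (fn s' T).map (Family.cart f.base b.leg) =
          (𝟙 _ ≫ (fn s T).map (Family.cart f.base b.leg)) ≫ τ b :=
        congrArg (fun Γ => at_ Γ T (AsSmall.up.obj b.leg)) (θ.naturality f.base.op)
      rw [Category.id_comp, Category.id_comp] at h₂
      change (fn s T).map f ≫ τ b = τ a ≫ (fn s' T).map f
      have e := Family.eq_vert_cart f
      have es := (congrArg (fn s T).map e).trans (Functor.map_comp _ _ _)
      have es' := (congrArg (fn s' T).map e).trans (Functor.map_comp _ _ _)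
      refine (congrArg (· ≫ τ b) es).trans (Eq.trans ?_ (congrArg (τ a ≫ ·) es').symm)
      exact (Category.assoc _ _ _).trans ((congrArg (_ ≫ ·) h₂.symm).trans
        ((Category.assoc _ _ _).symm.trans ((congrArg (· ≫ _) h₁).trans (Category.assoc _ _ _))))
    · have h := at_nat (θ.app (op a.idx)) g (AsSmall.up.obj a.leg)
      refine Eq.trans ?_ (h.trans ?_)
      · exact congrArg (_ ≫ ·) (nat_familiesLeg_comp s' a.idx g a.leg).symm
      · exact congrArg (· ≫ _) (nat_familiesLeg_comp s a.idx g a.leg)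
    · rfl
  · refine ⟨ReprCocone.desc d, ⟨LaxCocone.isoMk (fun j => modIsoMk
      (fun T => NatIso.ofComponents (fun h => Iso.refl _) (fun {h h'} ν => ?_)) ?_) ?_⟩⟩
    · refine (Category.comp_id _).trans (Eq.trans ?_ (Category.id_comp _).symm)
      exact ReprCocone.descFn_vert d ν.down
    · intro T T' g h
      refine (Category.id_comp _).trans ?_
      refine Eq.trans ?_ (congrArg (_ ≫ ·) (CategoryTheory.Functor.map_id _ _).symm)
      refine Eq.trans ?_ (Category.comp_id _).symm
      exact (nat_familiesLeg_comp (ReprCocone.desc d) j.unop g (AsSmall.down.obj h)).symm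
    · intro j k p
      refine mod_ext fun T h => ?_
      refine (Category.id_comp _).trans (Eq.trans ?_ (Category.comp_id _).symm)
      refine Eq.trans ?_ (Category.id_comp _).symm
      exact (ReprCocone.descFn_cart d p.unop (AsSmall.down.obj h)).symm

end Cocone

open CatTrans

/-! ### Reduction of the colimit condition to a pointwise equivalence. -/

section Reduction

variable {A : Type u} [Bicategory.{w, v} A] (F : A ⥤ᵖ Cat.{v₁, u₁})

/-- Lax conical colimits of representables are computed pointwise. -/
theorem isLaxConicalColimitOfRepresentables_iff :
    IsLaxConicalColimitOfRepresentables F ↔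
      ∃ (M : Type (max u v w u₁ v₁)) (_ : Category.{max u v w u₁ v₁} M)
        (P : LocallyDiscrete M ⥤ᵖ A) (s : families P ⟶ F.comp catAsSmall.{max u v w u₁ v₁}),
        ∀ T, (fn s T).IsEquivalence := by
  constructor
  · rintro ⟨M, _, P, c, hc⟩
    obtain ⟨s, r, ⟨e⟩, ⟨e'⟩⟩ :=
      (familiesCocone_isLaxColimit.{max u v w u₁ v₁} P).exists_equivalence hc
    exact ⟨M, _, P, s, isEquivalence_fn e e'⟩
  · rintro ⟨M, _, P, s, hs⟩
    exact ⟨M, _, P, _, (familiesCocone_isLaxColimit.{max u v w u₁ v₁} P).whisker s (inverse s)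
      (compInverseIso s) (inverseCompIso s)⟩

end Reduction

/-! ### Transformations from families to `F`, without the change of universe. -/

section Section

variable {A : Type u} [Bicategory.{w, v} A] {F : A ⥤ᵖ Cat.{v₁, u₁}}
  {J : Type (max u v w u₁ v₁)} [Bicategory.{w₂, max u v w u₁ v₁} J] [IsLocallyDiscrete J]
  {P : J ⥤ᵖ A}

section

variable (s : families P ⟶ F.comp catAsSmall.{max u v w u₁ v₁})

/-- The component at `T` of a transformation out of the pointwise lax colimit. -/
def sec (T : A) : Family P T ⥤ F.obj T :=
  (fn s T : Family P T ⥤ AsSmall.{max u v w u₁ v₁} (F.obj T)) ⋙ AsSmall.down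

instance [h : ∀ T, (fn s T).IsEquivalence] (T : A) : (sec s T).IsEquivalence := by
  have h₁ : (fn s T : Family P T ⥤ AsSmall.{max u v w u₁ v₁} (F.obj T)).IsEquivalence := h T
  have h₂ : (AsSmall.down : AsSmall.{max u v w u₁ v₁} (F.obj T) ⥤ F.obj T).IsEquivalence :=
    AsSmall.equiv.isEquivalence_inverse
  exact @Functor.isEquivalence_trans _ _ _ _ _ _ _ _ h₁ h₂

/-- The naturality isomorphism of `sec` at a family. -/
def secNat {T T' : A} (g : T ⟶ T') (a : Family P T) :
    (sec s T').obj ⟨a.idx, a.leg ≫ g⟩ ≅ (F.map g).toFunctor.obj ((sec s T).obj a) :=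
  (AsSmall.down : AsSmall.{max u v w u₁ v₁} (F.obj T') ⥤ F.obj T').mapIso (nat s g a)

theorem secNat_naturality {T T' : A} (g : T ⟶ T') {a b : Family P T} (f : a ⟶ b) :
    (sec s T').map (Family.pushMap g f) ≫ (secNat s g b).hom =
      (secNat s g a).hom ≫ (F.map g).toFunctor.map ((sec s T).map f) :=
  congrArg ULift.down (nat_naturality s g f)

theorem secNat_map₂ {T T' : A} {g g' : T ⟶ T'} (η : g ⟶ g') (a : Family P T) :
    (sec s T').map (Family.vert (a.leg ◁ η)) ≫ (secNat s g' a).hom =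
      (secNat s g a).hom ≫ map₂At F η ((sec s T).obj a) :=
  congrArg ULift.down (nat_map₂ s η a)

theorem secNat_comp {T T' T'' : A} (f : T ⟶ T') (g : T' ⟶ T'') (a : Family P T) :
    (secNat s (f ≫ g) a).hom ≫ (mapCompAt F f g ((sec s T).obj a)).hom =
      (sec s T'').map (Family.vert (α_ a.leg f g).inv) ≫
        (secNat s g ⟨a.idx, a.leg ≫ f⟩).hom ≫ (F.map g).toFunctor.map (secNat s f a).hom :=
  (congrArg (_ ≫ ·) (Category.comp_id _).symm).trans (congrArg ULift.down (nat_comp s f g a))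

end

/-- A transformation out of the pointwise lax colimit from elementwise data. -/
def ofSec (R : ∀ T, Family P T ⥤ F.obj T)
    (n : ∀ {T T' : A} (g : T ⟶ T'), Family.push g ⋙ R T' ≅ R T ⋙ (F.map g).toFunctor)
    (n_map₂ : ∀ {T T' : A} {g g' : T ⟶ T'} (η : g ⟶ g') (a : Family P T),
      (R T').map (Family.vert (a.leg ◁ η)) ≫ (n g').hom.app a =
        (n g).hom.app a ≫ map₂At F η ((R T).obj a))
    (n_id : ∀ (T : A) (a : Family P T),
      (n (𝟙 T)).hom.app a ≫ (mapIdAt F ((R T).obj a)).hom =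
        (R T).map (Family.vert (ρ_ a.leg).hom))
    (n_comp : ∀ {T T' T'' : A} (f : T ⟶ T') (g : T' ⟶ T'') (a : Family P T),
      (n (f ≫ g)).hom.app a ≫ (mapCompAt F f g ((R T).obj a)).hom =
        (R T'').map (Family.vert (α_ a.leg f g).inv) ≫
          (n g).hom.app ((Family.push f).obj a) ≫
            (F.map g).toFunctor.map ((n f).hom.app a)) :
    families P ⟶ F.comp catAsSmall.{max u v w u₁ v₁} :=
  CatTrans.mk (fun T => R T ⋙ AsSmall.up)
    (fun g => NatIso.ofComponents (fun a => AsSmall.up.mapIso ((n g).app a))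
      (fun f => small_hom_ext ((n g).hom.naturality f)))
    (fun η a => small_hom_ext (n_map₂ η a))
    (fun _ a => small_hom_ext ((congrArg (_ ≫ ·) (Category.comp_id _)).trans (n_id _ a)))
    (fun f g a => small_hom_ext ((congrArg (_ ≫ ·) (Category.comp_id _)).trans (n_comp f g a)))

end Section

/-! ### Isomorphisms in the categories of families. -/

namespace Family

variable {A : Type u} [Bicategory.{w, v} A] {J : Type u₁} [Bicategory.{w₂, v₁} J]
  [IsLocallyDiscrete J] {P : J ⥤ᵖ A} {T : A}

theorem vert_injective {j : J} {h h' : P.obj j ⟶ T} {ν μ : h ⟶ h'}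
    (e : vert (P := P) ν = vert μ) : ν = μ := by
  have e' : ν ≫ (λ_ h').inv ≫ (P.mapId j).inv ▷ h' = μ ≫ (λ_ h').inv ≫ (P.mapId j).inv ▷ h' :=
    eq_of_heq (Hom.mk.inj e).2
  rwa [cancel_mono] at e'

theorem exists_eq_vert {j : J} {h h' : P.obj j ⟶ T} (f : (⟨j, h⟩ : Family P T) ⟶ ⟨j, h'⟩)
    (e : f.base = 𝟙 j) : ∃ ν, f = vert ν := by
  obtain ⟨p, ν⟩ := f
  dsimp only at e
  subst e
  exact ⟨ν ≫ (P.mapId j).hom ▷ h' ≫ (λ_ h').hom, by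
    rw [← vert_cart, vert_comp, cart_id]⟩

theorem vert_comp_mk {j : J} {b : Family P T} {h h' : P.obj j ⟶ T} (ψ : h ⟶ h')
    (p : j ⟶ b.idx) (ν : h' ⟶ P.map p ≫ b.leg) :
    vert ψ ≫ (⟨p, ν⟩ : (⟨j, h'⟩ : Family P T) ⟶ b) = ⟨p, ψ ≫ ν⟩ := by
  have e := vert_cart (P := P) ν
  have e' := vert_cart (P := P) (ψ ≫ ν)
  rw [vert_comp, Category.assoc, e] at e'
  exact e'

theorem id_comp_eq {j k : J} (p : j ⟶ k) : 𝟙 j ≫ p = p := obj_ext_of_isDiscrete (λ_ p).hom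

theorem isIso_of_isIso_vert {j : J} {h h' : P.obj j ⟶ T} (ν : h ⟶ h')
    [i : IsIso (vert (P := P) ν)] : IsIso ν := by
  obtain ⟨f, hf, hf'⟩ := i
  obtain ⟨μ, rfl⟩ := exists_eq_vert f ((id_comp_eq _).symm.trans (congrArg Hom.base hf))
  exact ⟨μ, vert_injective ((vert_comp ν μ).trans (hf.trans (vert_id h).symm)),
    vert_injective ((vert_comp μ ν).trans (hf'.trans (vert_id h').symm))⟩

/-- A two-out-of-six argument: the cartesian morphism over `q` is preceded and followed by cartesian
morphisms over `p`, and both composites are invertible. The one over `q` is therefore split mono and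
split epi, hence invertible, and so is the one over `p` that follows it. -/
theorem isIso_cart_of_iso {j k : J} {p : j ⟶ k} {q : k ⟶ j} (e : p ≫ q = 𝟙 j) (e' : q ≫ p = 𝟙 k)
    (h : P.obj k ⟶ T) : IsIso (cart p h) := by
  -- Up to constraints of `P`, this composite is the cartesian morphism over `r ≫ r' = 𝟙 a`, which
  -- is vertical on an isomorphism.
  have key : ∀ {a b : J} (r : a ⟶ b) (r' : b ⟶ a), r ≫ r' = 𝟙 a → ∀ h : P.obj a ⟶ T,
      IsIso (cart r (P.map r' ≫ h) ≫ cart r' h) := by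
    intro a b r r' er h
    have h₁ := cart_comp r r' h
    have h₂ := cart_map₂ (P := P) (eqToHom er) h
    rw [cart_id, ← vert_comp] at h₂
    have : IsIso (cart (r ≫ r') h) := by rw [← h₂]; infer_instance
    exact IsIso.of_isIso_fac_left h₁.symm
  have h₁ := key p q e (P.map p ≫ h)
  have h₂ := key q p e' h
  have : IsSplitMono (cart q (P.map p ≫ h)) :=
    ⟨⟨cart p h ≫ inv (cart q (P.map p ≫ h) ≫ cart p h), by
      rw [← Category.assoc, IsIso.hom_inv_id]⟩⟩
  have : IsSplitEpi (cart q (P.map p ≫ h)) :=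
    ⟨⟨inv (cart p (P.map q ≫ P.map p ≫ h) ≫ cart q (P.map p ≫ h)) ≫
      cart p (P.map q ≫ P.map p ≫ h), by rw [Category.assoc, IsIso.inv_hom_id]⟩⟩
  have := isIso_of_mono_of_isSplitEpi (cart q (P.map p ≫ h))
  exact IsIso.of_isIso_comp_left (cart q (P.map p ≫ h)) (cart p h)

theorem isIso_cart_base {a b : Family P T} (f : a ⟶ b) [i : IsIso f] {T' : A}
    (h : P.obj b.idx ⟶ T') : IsIso (cart f.base h) := by
  obtain ⟨g, hf, hf'⟩ := i
  exact isIso_cart_of_iso (congrArg Hom.base hf) (congrArg Hom.base hf') h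

/-- The base of `f` is invertible, hence so is its cartesian factor; the vertical factor is then
invertible by cancellation. -/
theorem isIso_cell {a b : Family P T} (f : a ⟶ b) [i : IsIso f] : IsIso f.cell := by
  have := isIso_cart_base f b.leg
  have : IsIso (vert f.cell) := IsIso.of_isIso_fac_right (eq_vert_cart f).symm
  exact isIso_of_isIso_vert f.cell

theorem isIso_comp_cell {a b c : Family P T} (f : a ⟶ b) (g : b ⟶ c) [IsIso f.cell]
    [IsIso g.cell] : IsIso (f ≫ g).cell :=
  inferInstanceAs (IsIso (f.cell ≫ P.map f.base ◁ g.cell ≫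
    (α_ _ _ _).inv ≫ (P.mapComp f.base g.base).inv ▷ c.leg))

theorem isIso_pushMap_cell {S : A} {a b : Family P T} (f : a ⟶ b) (g : T ⟶ S) [IsIso f.cell] :
    IsIso (pushMap g f).cell :=
  inferInstanceAs (IsIso (f.cell ▷ g ≫ (α_ _ _ _).hom))

end Family

namespace El

variable {A : Type u} [Bicategory.{w, v} A] {F : A ⥤ᵖ Cat.{v₁, u₁}} {X Y Z : El F}

theorem comp_fiber (f : X ⟶ Y) (g : Y ⟶ Z) : (f ≫ g).fiber =
    (mapCompAt F f.base g.base X.fiber).hom ≫ (F.map g.base).toFunctor.map f.fiber ≫ g.fiber :=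
  rfl

theorem isIso_of_isIso_base {f g : X ⟶ Y} (p : f ⟶ g) [IsIso p.base] : IsIso p :=
  (isoMk (asIso p.base) p.w).isIso_hom

theorem isIso_base {f g : X ⟶ Y} (p : f ⟶ g) [IsIso p] : IsIso p.base :=
  ⟨(inv p).base, congrArg Hom₂.base (IsIso.hom_inv_id p), congrArg Hom₂.base (IsIso.inv_hom_id p)⟩

end El

/-! ### The elements `gen s j` and transposition of morphisms out of them. -/

section Section

variable {A : Type u} [Bicategory.{w, v} A] {F : A ⥤ᵖ Cat.{v₁, u₁}}
  {J : Type (max u v w u₁ v₁)} [Bicategory.{w₂, max u v w u₁ v₁} J] [IsLocallyDiscrete J]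
  {P : J ⥤ᵖ A} (s : families P ⟶ F.comp catAsSmall.{max u v w u₁ v₁})

/-- The element of `F` that corresponds to the identity of `P j`. -/
abbrev gen (j : J) : El F := ⟨P.obj j, (sec s _).obj ⟨j, 𝟙 (P.obj j)⟩⟩

/-- The values of the comparison are determined by the elements `gen j`. -/
def genIso {j : J} {T : A} (h : P.obj j ⟶ T) :
    (F.map h).toFunctor.obj (gen s j).fiber ≅ (sec s T).obj ⟨j, h⟩ :=
  (secNat s h ⟨j, 𝟙 (P.obj j)⟩).symm ≪≫ (sec s T).mapIso (Family.vertIso (λ_ h))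

theorem genIso_map₂ {j : J} {T : A} {h h' : P.obj j ⟶ T} (ν : h ⟶ h') :
    map₂At F ν (gen s j).fiber ≫ (genIso s h').hom =
      (genIso s h).hom ≫ (sec s T).map (Family.vert ν) := by
  have e := secNat_map₂ s ν ⟨j, 𝟙 (P.obj j)⟩
  have e' := congrArg (fun x => (sec s T).map (Family.vert (P := P) x)) (leftUnitor_naturality ν)
  simp only [Family.vert_comp, Functor.map_comp] at e'
  simp only [genIso, Iso.trans_hom, Iso.symm_hom, Functor.mapIso_hom, Family.vertIso_hom,
    Category.assoc]
  rw [← cancel_epi (secNat s h ⟨j, 𝟙 (P.obj j)⟩).hom, ← reassoc_of% e, Iso.hom_inv_id_assoc,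
    Iso.hom_inv_id_assoc, e']

/-- This yields `hat_comp`: composition of elements becomes pushing families forward. The companion
`genIso_map₂` turns 2-cells into vertical morphisms. -/
theorem genIso_comp {j : J} {T T' : A} (h : P.obj j ⟶ T) (g : T ⟶ T') :
    (mapCompAt F h g (gen s j).fiber).hom ≫ (F.map g).toFunctor.map (genIso s h).hom =
      (genIso s (h ≫ g)).hom ≫ (secNat s g ⟨j, h⟩).hom := by
  have e := secNat_comp s h g ⟨j, 𝟙 (P.obj j)⟩
  have e' := secNat_naturality s g (Family.vert (P := P) (j := j) (λ_ h).hom)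
  rw [Family.pushMap_vert] at e'
  simp only [genIso, Iso.trans_hom, Iso.symm_hom, Functor.mapIso_hom, Family.vertIso_hom,
    Category.assoc, Functor.map_comp]
  rw [← cancel_epi (secNat s (h ≫ g) ⟨j, 𝟙 (P.obj j)⟩).hom, reassoc_of% e, ← Functor.map_comp_assoc,
    Iso.hom_inv_id, CategoryTheory.Functor.map_id, Category.id_comp, Iso.hom_inv_id_assoc, ← e',
    ← Functor.map_comp_assoc, ← Family.vert_comp]
  simp

variable {s}

/-- Morphisms out of `gen j` correspond to morphisms out of values of the comparison. -/
def hat {j : J} {Y : El F} (l : gen s j ⟶ Y) : (sec s Y.base).obj ⟨j, l.base⟩ ⟶ Y.fiber :=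
  (genIso s l.base).inv ≫ l.fiber

theorem genIso_hat {j : J} {Y : El F} (l : gen s j ⟶ Y) :
    (genIso s l.base).hom ≫ hat l = l.fiber := by
  simp [hat]

/-- The morphism out of `gen s j` with a given transpose `hat`. -/
abbrev ofHat {j : J} {Y : El F} (h : P.obj j ⟶ Y.base)
    (a : (sec s Y.base).obj ⟨j, h⟩ ⟶ Y.fiber) :
    gen s j ⟶ Y :=
  ⟨h, (genIso s h).hom ≫ a⟩

theorem hat_ofHat {j : J} {Y : El F} (h : P.obj j ⟶ Y.base)
    (a : (sec s Y.base).obj ⟨j, h⟩ ⟶ Y.fiber) : hat (ofHat h a) = a :=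
  Iso.inv_hom_id_assoc _ _

theorem hat_comp {j : J} {Y Z : El F} (l : gen s j ⟶ Y) (g : Y ⟶ Z) :
    hat (l ≫ g) = (secNat s g.base ⟨j, l.base⟩).hom ≫ (F.map g.base).toFunctor.map (hat l) ≫
      g.fiber := by
  have e := genIso_comp s l.base g.base
  change (genIso s (l.base ≫ g.base)).inv ≫ (l ≫ g).fiber = _
  rw [Iso.inv_comp_eq, El.comp_fiber, ← reassoc_of% e, ← Functor.map_comp_assoc, genIso_hat]

theorem vert_hat {j : J} {Y : El F} {l l' : gen s j ⟶ Y} (ν : l ⟶ l') :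
    (sec s Y.base).map (Family.vert ν.base) ≫ hat l' = hat l := by
  have e := genIso_map₂ s ν.base
  have w : map₂At F ν.base (gen s j).fiber ≫ l'.fiber = l.fiber := ν.w
  rw [← cancel_epi (genIso s l.base).hom, ← reassoc_of% e, genIso_hat, genIso_hat, w]

/-- A 2-cell between morphisms out of `gen s j` from a compatibility of their transposes. -/
def homOfHat {j : J} {Y : El F} {l l' : gen s j ⟶ Y} (ν : l.base ⟶ l'.base)
    (h : (sec s Y.base).map (Family.vert ν) ≫ hat l' = hat l) : l ⟶ l' :=
  ⟨ν, by
    have e := genIso_map₂ s ν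
    change map₂At F ν (gen s j).fiber ≫ l'.fiber = l.fiber
    rw [← genIso_hat, reassoc_of% e, h, genIso_hat]⟩

end Section

/-! ### Conditions (a) and (b) for a pointwise lax colimit of representables. -/

section Section

variable {A : Type u} [Bicategory.{w, v} A] {F : A ⥤ᵖ Cat.{v₁, u₁}}
  {J : Type (max u v w u₁ v₁)} [Bicategory.{w₂, max u v w u₁ v₁} J] [IsLocallyDiscrete J]
  {P : J ⥤ᵖ A} {s : families P ⟶ F.comp catAsSmall.{max u v w u₁ v₁}}

/-- The morphism out of `gen j` obtained from a morphism of the index category. -/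
abbrev std {j : J} {Y : El F} {b : Family P Y.base} (β : (sec s Y.base).obj b ≅ Y.fiber)
    (p : j ⟶ b.idx) : gen s j ⟶ Y :=
  ofHat (P.map p ≫ b.leg) ((sec s Y.base).map (Family.cart p b.leg) ≫ β.hom)

theorem hat_std {j : J} {Y : El F} {b : Family P Y.base} (β : (sec s Y.base).obj b ≅ Y.fiber)
    (p : j ⟶ b.idx) : hat (std β p) = (sec s Y.base).map (Family.cart p b.leg) ≫ β.hom :=
  hat_ofHat _ _

/-- The 2-cell into `std β p` defined by a representing morphism of families. -/
def toStd {j : J} {Y : El F} {b : Family P Y.base} (β : (sec s Y.base).obj b ≅ Y.fiber)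
    {l : gen s j ⟶ Y} {p : j ⟶ b.idx} {ν : l.base ⟶ P.map p ≫ b.leg}
    (h : (sec s Y.base).map (⟨p, ν⟩ : (⟨j, l.base⟩ : Family P Y.base) ⟶ b) ≫ β.hom = hat l) :
    l ⟶ std β p :=
  homOfHat ν (by
    rw [hat_std]
    change (sec s Y.base).map (Family.vert ν) ≫
      (sec s Y.base).map (Family.cart p b.leg) ≫ β.hom = _
    rw [← Functor.map_comp_assoc, Family.vert_cart, h])

/-! #### Cartesian morphisms of the fibers -/

variable (s) in
/-- Morphisms that correspond to a pair of a morphism of the index category and an invertible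
2-cell. -/
def IsCart {T : A} {x y : F.obj T} (φ : x ⟶ y) : Prop :=
  ∃ (a b : Family P T) (e : x ≅ (sec s T).obj a) (e' : (sec s T).obj b ≅ y) (f : a ⟶ b),
    IsIso f.cell ∧ φ = e.hom ≫ (sec s T).map f ≫ e'.hom

theorem IsCart.iso_comp {T : A} {x y z : F.obj T} {φ : x ⟶ y} (h : IsCart s φ) (i : z ⟶ x)
    [IsIso i] : IsCart s (i ≫ φ) := by
  obtain ⟨a, b, e, e', f, hf, rfl⟩ := h
  exact ⟨a, b, asIso i ≪≫ e, e', f, hf, by simp⟩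

/-- Under `s`, the functor `F g` corresponds to pushing families along `g`, which whiskers the cell
and so keeps it invertible. -/
theorem IsCart.map {T T' : A} {x y : F.obj T} {φ : x ⟶ y} (h : IsCart s φ) (g : T ⟶ T') :
    IsCart s ((F.map g).toFunctor.map φ) := by
  obtain ⟨a, b, e, e', f, hf, rfl⟩ := h
  refine ⟨_, _, (F.map g).toFunctor.mapIso e ≪≫ (secNat s g a).symm,
    secNat s g b ≪≫ (F.map g).toFunctor.mapIso e', Family.pushMap g f,
    Family.isIso_pushMap_cell f g, ?_⟩
  have h := secNat_naturality s g f
  simp [reassoc_of% h]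

variable [∀ T, (fn s T).IsEquivalence]

theorem exists_obj_iso (Y : El F) :
    ∃ b : Family P Y.base, Nonempty ((sec s Y.base).obj b ≅ Y.fiber) :=
  ⟨_, ⟨(sec s Y.base).objObjPreimageIso Y.fiber⟩⟩

/-- Fullness of `sec` turns the transpose of `l` into an index `p` and a 2-cell `ν`; by `toStd`, `ν`
is a 2-cell from `l` to `std β p`. -/
theorem exists_rep {j : J} {Y : El F} {b : Family P Y.base} (β : (sec s Y.base).obj b ≅ Y.fiber)
    (l : gen s j ⟶ Y) : ∃ (p : j ⟶ b.idx) (ν : l.base ⟶ P.map p ≫ b.leg),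
      (sec s Y.base).map (⟨p, ν⟩ : (⟨j, l.base⟩ : Family P Y.base) ⟶ b) ≫ β.hom = hat l := by
  obtain ⟨f, hf⟩ := (sec s Y.base).map_surjective (hat l ≫ β.inv)
  obtain ⟨p, ν⟩ := f
  exact ⟨p, ν, by rw [hf, Category.assoc, Iso.inv_hom_id, Category.comp_id]⟩

/-- A 2-cell `l ⟶ std β p` is the cell of a morphism of families over `p` whose image is fixed by
`hat l`, so faithfulness of `sec` leaves no choice. -/
theorem std_subterminal {j : J} {Y : El F} {b : Family P Y.base}
    (β : (sec s Y.base).obj b ≅ Y.fiber) (p : j ⟶ b.idx) : IsSubterminalObj (std β p) := by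
  intro l ν μ
  have e := (vert_hat ν).trans (vert_hat μ).symm
  rw [hat_std, ← Functor.map_comp_assoc, ← Functor.map_comp_assoc, cancel_mono] at e
  exact El.hom₂_ext (Family.vert_cart_injective ((sec s Y.base).map_injective e))

/-- The index is invariant along 2-cells: if `std β p` maps to `l`, a representative of `l` must lie
over `p`, and its cell is then a 2-cell back to `std β p`. -/
theorem std_generic {j : J} {Y : El F} {b : Family P Y.base}
    (β : (sec s Y.base).obj b ≅ Y.fiber) (p : j ⟶ b.idx) : IsGenericObj (std β p) := by
  refine ⟨std_subterminal β p, fun l ψ => ?_⟩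
  obtain ⟨q, ν, h⟩ := exists_rep β l
  have e := vert_hat ψ
  rw [hat_std, ← h, ← Functor.map_comp_assoc, cancel_mono] at e
  have e' := (sec s Y.base).map_injective e
  rw [Family.vert_comp_mk] at e'
  obtain rfl : q = p := (Family.Hom.mk.inj e').1
  exact ⟨toStd β h⟩

theorem isIso_of_isGenericObj {j : J} {Y : El F} {b : Family P Y.base}
    (β : (sec s Y.base).obj b ≅ Y.fiber) {l : gen s j ⟶ Y} (hl : IsGenericObj l)
    {p : j ⟶ b.idx} {ν : l.base ⟶ P.map p ≫ b.leg}
    (h : (sec s Y.base).map (⟨p, ν⟩ : (⟨j, l.base⟩ : Family P Y.base) ⟶ b) ≫ β.hom = hat l) :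
    IsIso ν := by
  have := hl.isIso (std_subterminal β p) (toStd β h)
  exact El.isIso_base (toStd β h)

variable (s) in
/-- The elements `gen j` are lax el-generic. -/
theorem gen_isLaxElGeneric (j : J) : (gen s j).IsLaxElGeneric := by
  intro Y Z f g hg
  have : IsIso g.fiber := hg
  obtain ⟨b, ⟨β⟩⟩ := exists_obj_iso (s := s) Z
  -- As `g` is opcartesian, a family representing `Z`, pushed forward along `g.base`, represents `Y`
  -- with the same index. One index therefore serves both `f` and its lifting.
  let b' : Family P Y.base := ⟨b.idx, b.leg ≫ g.base⟩
  let γ : (sec s Y.base).obj b' ≅ Y.fiber :=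
    secNat s g.base b ≪≫ (F.map g.base).toFunctor.mapIso β ≪≫ asIso g.fiber
  have hγ : γ.hom = (secNat s g.base b).hom ≫ (F.map g.base).toFunctor.map β.hom ≫ g.fiber := rfl
  -- representatives of composites with `g`
  have comp : ∀ (k : gen s j ⟶ Z) (q : j ⟶ b.idx) (μ : k.base ⟶ P.map q ≫ b.leg),
      (sec s Z.base).map (⟨q, μ⟩ : (⟨j, k.base⟩ : Family P Z.base) ⟶ b) ≫ β.hom = hat k →
      (sec s Y.base).map (⟨q, μ ▷ g.base ≫ (α_ _ _ _).hom⟩ :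
        (⟨j, k.base ≫ g.base⟩ : Family P Y.base) ⟶ b') ≫ γ.hom = hat (k ≫ g) := by
    intro k q μ h
    have e := secNat_naturality s g.base (⟨q, μ⟩ : (⟨j, k.base⟩ : Family P Z.base) ⟶ b)
    rw [hat_comp, ← h, hγ, Functor.map_comp_assoc, ← reassoc_of% e]
    rfl
  obtain ⟨p, ν, hν⟩ := exists_rep γ f
  have hstd : (sec s Z.base).map (⟨p, 𝟙 _⟩ : (⟨j, (std β p).base⟩ : Family P Z.base) ⟶ b) ≫
      β.hom = hat (std β p) := (hat_std β p).symm
  let ν' : f ⟶ std β p ≫ g := homOfHat (ν ≫ (α_ (P.map p) b.leg g.base).inv) (by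
    rw [← comp _ _ _ hstd, ← Functor.map_comp_assoc, Family.vert_comp_mk, ← hν]
    simp)
  refine ⟨std β p, ν', ⟨fun k ψ => ?_, std_subterminal β p⟩, fun hf => ?_⟩
  -- Represent `k` by `(q, μ)`. Composing with `g` and precomposing with `ψ` gives a second
  -- representative of `f`, so `q = p`, and `μ` itself is the required 2-cell, with the equality of
  -- cells as its triangle.
  · obtain ⟨q, μ, hμ⟩ := exists_rep β k
    have e := vert_hat ψ
    rw [← comp _ _ _ hμ, ← hν, ← Functor.map_comp_assoc, cancel_mono] at e
    have e' := (sec s Y.base).map_injective e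
    rw [Family.vert_comp_mk] at e'
    obtain ⟨rfl, e''⟩ := Family.Hom.mk.inj e'
    refine ⟨toStd β hμ, El.hom₂_ext ?_, fun _ _ => std_subterminal β _ _ _⟩
    have e₃ : ψ.base ≫ μ ▷ g.base ≫ (α_ _ _ _).hom = ν := eq_of_heq e''
    change ψ.base ≫ μ ▷ g.base = ν ≫ (α_ _ _ _).inv
    rw [← e₃]
    simp
  · have : IsIso f.fiber := hf
    have : IsIso (hat f) := inferInstanceAs (IsIso ((genIso s f.base).inv ≫ f.fiber))
    -- The transpose of an opcartesian `f` is invertible, hence so is its representative `(p, ν)`.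
    -- Its cell gives invertibility of the lifting 2-cell, and its base makes the standard morphism
    -- opcartesian.
    have : IsIso ((sec s Y.base).map (⟨p, ν⟩ : (⟨j, f.base⟩ : Family P Y.base) ⟶ b')) :=
      IsIso.of_isIso_fac_right hν
    have i : IsIso (⟨p, ν⟩ : (⟨j, f.base⟩ : Family P Y.base) ⟶ b') :=
      isIso_of_reflects_iso _ (sec s Y.base)
    have : IsIso ν := Family.isIso_cell (⟨p, ν⟩ : (⟨j, f.base⟩ : Family P Y.base) ⟶ b')
    have : IsIso (Family.cart (P := P) p b.leg) :=
      Family.isIso_cart_base (⟨p, ν⟩ : (⟨j, f.base⟩ : Family P Y.base) ⟶ b') b.leg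
    have : IsIso ν'.base := inferInstanceAs (IsIso (ν ≫ (α_ (P.map p) b.leg g.base).inv))
    exact ⟨inferInstanceAs (IsIso ((genIso s _).hom ≫
      (sec s Z.base).map (Family.cart p b.leg) ≫ β.hom)), El.isIso_of_isIso_base ν'⟩

theorem exists_opcartesian (Y : El F) : ∃ (j : J) (e : gen s j ⟶ Y), El.IsOpcartesian e := by
  obtain ⟨b, ⟨β⟩⟩ := exists_obj_iso (s := s) Y
  exact ⟨b.idx, ofHat b.leg β.hom, inferInstanceAs (IsIso ((genIso s _).hom ≫ β.hom))⟩

/-- The two presentations of the middle object differ by an isomorphism, which lifts to an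
isomorphism of families; its cell is invertible too, so the composite cell is. -/
theorem IsCart.comp {T : A} {x y z : F.obj T} {φ : x ⟶ y} {ψ : y ⟶ z} (h : IsCart s φ)
    (h' : IsCart s ψ) : IsCart s (φ ≫ ψ) := by
  obtain ⟨a, b, e, e', f, hf, rfl⟩ := h
  obtain ⟨a', b', i, i', f', hf', rfl⟩ := h'
  let m : b ≅ a' := (sec s T).preimageIso (e' ≪≫ i)
  have := Family.isIso_cell m.hom
  have := Family.isIso_comp_cell m.hom f'
  have hm : (sec s T).map m.hom = e'.hom ≫ i.hom := (sec s T).map_preimage _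
  exact ⟨a, b', e, i', f ≫ m.hom ≫ f', Family.isIso_comp_cell f _, by simp [hm]⟩

/-- Both sides say that the comparison 2-cell from `l` to a standard morphism is invertible. The
right side involves only the fiber component, which is what makes it composable. -/
theorem isGenericObj_iff_isCart_of_gen {j : J} {Y : El F} (l : gen s j ⟶ Y) :
    IsGenericObj l ↔ IsCart s l.fiber := by
  constructor
  · intro h
    obtain ⟨b, ⟨β⟩⟩ := exists_obj_iso (s := s) Y
    obtain ⟨p, ν, hν⟩ := exists_rep β l
    exact ⟨_, b, genIso s l.base, β, ⟨p, ν⟩, isIso_of_isGenericObj β h hν, by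
      rw [hν, genIso_hat]⟩
  · rintro ⟨a, b, e, β, f, hf, h⟩
    -- The given presentation may start at another family; correcting it by `m` makes `m.hom ≫ f` a
    -- representative of `l`, still with invertible cell.
    let m : (⟨j, l.base⟩ : Family P Y.base) ≅ a :=
      (sec s Y.base).preimageIso ((genIso s l.base).symm ≪≫ e)
    have hm : (sec s Y.base).map m.hom = (genIso s l.base).inv ≫ e.hom :=
      (sec s Y.base).map_preimage _
    have := Family.isIso_cell m.hom
    have i := Family.isIso_comp_cell m.hom f
    have hr : (sec s Y.base).map (m.hom ≫ f) ≫ β.hom = hat l := by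
      rw [Functor.map_comp, hm, hat, h]
      simp
    have : IsIso (toStd β (ν := (m.hom ≫ f).cell) hr).base := i
    have := El.isIso_of_isIso_base (toStd β (ν := (m.hom ≫ f).cell) hr)
    exact (std_generic β _).of_iso (asIso (toStd β (ν := (m.hom ≫ f).cell) hr)).symm

/-- Every lax el-generic `X` is equivalent in `El F` to some `gen s j` through an opcartesian `e`.
Precomposition with `e` preserves and reflects genericity, and alters the fiber component only by an
isomorphism. -/
theorem isGenericObj_iff_isCart {X Y : El F} (hX : X.IsLaxElGeneric) (l : X ⟶ Y) :
    IsGenericObj l ↔ IsCart s l.fiber := by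
  obtain ⟨j, e, he⟩ := exists_opcartesian (s := s) X
  obtain ⟨r, -, ⟨i⟩, ⟨i'⟩⟩ := (gen_isLaxElGeneric s j).exists_inverse hX he
  let E := precompEquivalence e r i i' Y
  have : IsIso e.fiber := he
  have h₁ : IsGenericObj l ↔ IsGenericObj (e ≫ l) :=
    ⟨fun h => h.map_equivalence E,
      fun h => (h.map_equivalence E.symm).of_iso (E.unitIso.app l).symm⟩
  have h₂ : (e ≫ l).fiber = ((mapCompAt F e.base l.base (gen s j).fiber).hom ≫
      (F.map l.base).toFunctor.map e.fiber) ≫ l.fiber := (Category.assoc _ _ _).symm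
  rw [h₁, isGenericObj_iff_isCart_of_gen, h₂]
  refine ⟨fun h => ?_, fun h => h.iso_comp _⟩
  have := h.iso_comp (inv ((mapCompAt F e.base l.base (gen s j).fiber).hom ≫
      (F.map l.base).toFunctor.map e.fiber))
  rwa [IsIso.inv_hom_id_assoc] at this

/-- If `F` is equivalent to a pointwise lax colimit of representables, then generic morphisms are
closed under composition. -/
theorem IsElGenericMor.comp {X Y Z : El F} (s : families P ⟶ F.comp catAsSmall.{max u v w u₁ v₁})
    [∀ T, (fn s T).IsEquivalence] {f : X ⟶ Y} {g : Y ⟶ Z}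
    (hX : X.IsLaxElGeneric) (hY : Y.IsLaxElGeneric) (hf : El.IsElGenericMor f)
    (hg : El.IsElGenericMor g) : El.IsElGenericMor (f ≫ g) := by
  rw [El.isElGenericMor_iff, isGenericObj_iff_isCart (s := s) (by assumption)] at hf hg ⊢
  exact ((hf.map g.base).comp hg).iso_comp (mapCompAt F f.base g.base X.fiber).hom

end Section

/-! ### Coherence of `Cat`-valued pseudofunctors, elementwise -/

namespace CatTrans

variable {A : Type u} [Bicategory.{w, v} A] (F : A ⥤ᵖ Cat.{v₁, u₁})

theorem map₂At_id {T T' : A} (h : T ⟶ T') (x : F.obj T) : map₂At F (𝟙 h) x = 𝟙 _ := by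
  simp [map₂At]

theorem map₂At_whiskerLeft {T T' T'' : A} (h : T ⟶ T') {g g' : T' ⟶ T''} (η : g ⟶ g')
    (x : F.obj T) : map₂At F (h ◁ η) x ≫ (mapCompAt F h g' x).hom =
      (mapCompAt F h g x).hom ≫ map₂At F η ((F.map h).toFunctor.obj x) := by
  rw [map₂At, F.map₂_whisker_left_app]
  simp [mapCompAt, map₂At]

theorem map₂At_rightUnitor {T T' : A} (h : T ⟶ T') (x : F.obj T) :
    map₂At F (ρ_ h).hom x = (mapCompAt F h (𝟙 T') x).hom ≫ (mapIdAt F _).hom :=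
  F.map₂_right_unitor_app h x

theorem map₂At_associator_inv {T T' T'' T''' : A} (h : T ⟶ T') (f : T' ⟶ T'') (g : T'' ⟶ T''')
    (x : F.obj T) :
    map₂At F (α_ h f g).inv x ≫ (mapCompAt F (h ≫ f) g x).hom ≫
      (F.map g).toFunctor.map (mapCompAt F h f x).hom =
        (mapCompAt F h (f ≫ g) x).hom ≫ (mapCompAt F f g ((F.map h).toFunctor.obj x)).hom := by
  have e : map₂At F (α_ h f g).inv x ≫ map₂At F (α_ h f g).hom x = 𝟙 _ := by
    rw [map₂At, map₂At, ← Cat.Hom₂.comp_app, ← PrelaxFunctor.map₂_comp, Iso.inv_hom_id]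
    exact map₂At_id F _ x
  rw [← cancel_mono (mapCompAt F f g ((F.map h).toFunctor.obj x)).inv,
    ← cancel_mono (mapCompAt F h (f ≫ g) x).inv]
  have e₁ : map₂At F (α_ h f g).hom x = _ := F.map₂_associator_app h f g x
  rw [e₁] at e
  refine Eq.trans ?_ (e.trans (by simp))
  simp only [Category.assoc]
  rfl

end CatTrans

/-! ### The category of generic morphisms -/

/-- A class of objects of a bicategory for which generic morphisms contain the identities and are
closed under composition. -/
structure GenericSystem (C : Type u) [Bicategory.{w, v} C] where
  carrier : C → Prop
  id_generic {X : C} (hX : carrier X) : IsGenericObj (𝟙 X)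
  comp_generic {X Y Z : C} {f : X ⟶ Y} {g : Y ⟶ Z} (hX : carrier X) (hY : carrier Y)
    (hZ : carrier Z) (hf : IsGenericObj f) (hg : IsGenericObj g) : IsGenericObj (f ≫ g)

namespace GenericSystem

variable {C : Type u} [Bicategory.{w, v} C]

/-- The objects of the category of generic morphisms. -/
structure Index (G : GenericSystem C) : Type (max t u) where
  obj : C
  mem : G.carrier obj

namespace Index

variable {G : GenericSystem C}

/-- Generic morphisms are identified if they are isomorphic. -/
instance setoid (X Y : C) : Setoid {f : X ⟶ Y // IsGenericObj f} where
  r f g := Nonempty (f.1 ≅ g.1)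
  iseqv := ⟨fun _ => ⟨Iso.refl _⟩, fun ⟨e⟩ => ⟨e.symm⟩, fun ⟨e⟩ ⟨e'⟩ => ⟨e ≪≫ e'⟩⟩

/-- Isomorphism classes of generic morphisms. -/
def Hom (X Y : Index.{t} G) : Type (max t v) := ULift.{t} (Quotient (setoid X.obj Y.obj))

/-- A representative of an isomorphism class of generic morphisms. -/
noncomputable def rep {X Y : Index.{t} G} (p : Hom X Y) : X.obj ⟶ Y.obj := (Quotient.out p.down).1

theorem rep_generic {X Y : Index.{t} G} (p : Hom X Y) : IsGenericObj (rep p) :=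
  (Quotient.out p.down).2

/-- The class of a generic morphism. -/
def cls {X Y : Index.{t} G} (f : X.obj ⟶ Y.obj) (hf : IsGenericObj f) : Hom X Y :=
  ⟨Quotient.mk _ ⟨f, hf⟩⟩

/-- The representative of the class of a generic morphism is isomorphic to the morphism. -/
noncomputable def repIso {X Y : Index.{t} G} (f : X.obj ⟶ Y.obj) (hf : IsGenericObj f) :
    rep (cls f hf) ≅ f :=
  (Quotient.exact (Quotient.out_eq (Quotient.mk (setoid X.obj Y.obj) ⟨f, hf⟩)) :
    Nonempty (rep (cls f hf) ≅ f)).some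

theorem eq_of_iso {X Y : Index.{t} G} {p q : Hom X Y} (e : rep p ≅ rep q) : p = q :=
  ULift.ext _ _ (Quotient.out_equiv_out.1 ⟨e⟩)

noncomputable instance category : Category.{max t v} (Index.{t} G) where
  Hom := Hom
  id X := cls (𝟙 X.obj) (G.id_generic X.mem)
  comp {X Y Z} p q := cls (rep p ≫ rep q)
    (G.comp_generic X.mem Y.mem Z.mem (rep_generic p) (rep_generic q))
  id_comp _ := eq_of_iso (repIso _ _ ≪≫ whiskerRightIso (repIso _ _) _ ≪≫ λ_ _)
  comp_id _ := eq_of_iso (repIso _ _ ≪≫ whiskerLeftIso _ (repIso _ _) ≪≫ ρ_ _)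
  assoc _ _ _ := eq_of_iso (repIso _ _ ≪≫ whiskerRightIso (repIso _ _) _ ≪≫ α_ _ _ _ ≪≫
    whiskerLeftIso _ (repIso _ _).symm ≪≫ (repIso _ _).symm)

variable (G) in
/-- The choice of representatives is a pseudofunctor. -/
noncomputable def incl : LocallyDiscrete (Index.{t} G) ⥤ᵖ C where
  obj X := X.as.obj
  map p := rep p.as
  map₂ η := eqToHom (by rw [LocallyDiscrete.eq_of_hom η])
  mapId X := repIso _ _
  mapComp p q := repIso _ _
  -- Each axiom equates two parallel 2-cells into a chosen generic representative, so subterminality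
  -- proves all of them.
  map₂_id p := (rep_generic p.as).1 _ _
  map₂_comp {_ _ _ _ r} _ _ := (rep_generic r.as).1 _ _
  map₂_whisker_left p _ _ _ := (rep_generic (p ≫ _).as).1 _ _
  map₂_whisker_right _ r := (rep_generic (_ ≫ r).as).1 _ _
  map₂_associator p q r := (rep_generic (p ≫ q ≫ r).as).1 _ _
  map₂_left_unitor p := (rep_generic p.as).1 _ _
  map₂_right_unitor p := (rep_generic p.as).1 _ _

end Index

end GenericSystem

/-! ### Transformations induced by diagrams of elements -/

section Elements

variable {A : Type u} [Bicategory.{w, v} A] {F : A ⥤ᵖ Cat.{v₁, u₁}}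

theorem comp_comp_id_comp {C : Type u₁} [Category.{v₁} C] {a b c d e : C} (p : a ⟶ b) (q : b ⟶ c)
    (r : c ⟶ d) (s : d ⟶ e) : p ≫ q ≫ r ≫ s = (p ≫ q ≫ r ≫ 𝟙 _) ≫ s := by
  simp

namespace El

variable (F) in
/-- The projection from the bicategory of elements. -/
def proj : El F ⥤ᵖ A where
  obj X := X.base
  map f := f.base
  map₂ η := η.base
  mapId _ := Iso.refl _
  mapComp _ _ := Iso.refl _
  map₂_id _ := rfl
  map₂_comp _ _ := rfl
  map₂_whisker_left f _ _ η := by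
    change f.base ◁ η.base = 𝟙 _ ≫ _ ≫ 𝟙 _
    simp
  map₂_whisker_right η h := by
    change η.base ▷ h.base = 𝟙 _ ≫ _ ≫ 𝟙 _
    simp
  map₂_associator f g h := by
    change (α_ f.base g.base h.base).hom = 𝟙 _ ≫ 𝟙 _ ▷ _ ≫ _ ≫ _ ◁ 𝟙 _ ≫ 𝟙 _
    simp
  map₂_left_unitor f := by
    change (λ_ f.base).hom = 𝟙 _ ≫ 𝟙 _ ▷ _ ≫ _
    simp
  map₂_right_unitor f := by
    change (ρ_ f.base).hom = 𝟙 _ ≫ _ ◁ 𝟙 _ ≫ _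
    simp

/-- A morphism of elements with given components. -/
abbrev homMk (X : El F) {T : A} (h : X.base ⟶ T) {y : F.obj T}
    (φ : (F.map h).toFunctor.obj X.fiber ⟶ y) : X ⟶ (⟨T, y⟩ : El F) := ⟨h, φ⟩

/-- The opcartesian lift of a 1-cell. -/
abbrev lift (X : El F) {T : A} (h : X.base ⟶ T) :
    X ⟶ (⟨T, (F.map h).toFunctor.obj X.fiber⟩ : El F) := ⟨h, 𝟙 _⟩

theorem isOpcartesian_lift (X : El F) {T : A} (h : X.base ⟶ T) : IsOpcartesian (X.lift h) :=
  inferInstanceAs (IsIso (𝟙 _))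

end El

variable {J : Type (max u v w u₁ v₁)} [Bicategory.{w₂, max u v w u₁ v₁} J] [IsLocallyDiscrete J]
  (Q : J ⥤ᵖ El F)

/-- The action on morphisms of `ofElements`. -/
def ofElementsMap {T : A} {a b : Family (Q.comp (El.proj F)) T} (f : a ⟶ b) :
    (F.map a.leg).toFunctor.obj (Q.obj a.idx).fiber ⟶
      (F.map b.leg).toFunctor.obj (Q.obj b.idx).fiber :=
  map₂At F f.cell (Q.obj a.idx).fiber ≫ (Q.map f.base ≫ (Q.obj b.idx).lift b.leg).fiber

/-- The morphism of elements defined by a morphism of families. -/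
abbrev ofElementsHom {T : A} {a b : Family (Q.comp (El.proj F)) T} (f : a ⟶ b) :
    Q.obj a.idx ⟶ (⟨T, (F.map b.leg).toFunctor.obj (Q.obj b.idx).fiber⟩ : El F) :=
  ⟨a.leg, ofElementsMap Q f⟩

/-- The 2-cell that defines `ofElementsMap`. -/
abbrev ofElementsCell {T : A} {a b : Family (Q.comp (El.proj F)) T} (f : a ⟶ b) :
    ofElementsHom Q f ⟶ Q.map f.base ≫ (Q.obj b.idx).lift b.leg := ⟨f.cell, rfl⟩

/-- The fiber of the source of a 2-cell of elements is determined by its target and base. Equations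
for `ofElementsMap` thus follow by exhibiting a 2-cell in `El F`, whose bicategory structure already
contains the coherence of `F`. -/
theorem ofElementsMap_eq {T : A} {a b : Family (Q.comp (El.proj F)) T} (f : a ⟶ b)
    {φ : (F.map a.leg).toFunctor.obj (Q.obj a.idx).fiber ⟶
      (F.map b.leg).toFunctor.obj (Q.obj b.idx).fiber}
    (θ : (Q.obj a.idx).homMk a.leg φ ⟶ Q.map f.base ≫ (Q.obj b.idx).lift b.leg)
    (h : θ.base = f.cell) :
    ofElementsMap Q f = φ := by
  rw [ofElementsMap, ← h]
  exact θ.w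

theorem ofElementsMap_vert {T : A} {j : J} {h h' : (Q.obj j).base ⟶ T} (ν : h ⟶ h') :
    ofElementsMap Q (Family.vert (P := Q.comp (El.proj F)) (j := j) ν) =
      map₂At F ν (Q.obj j).fiber := by
  let θ₀ : (Q.obj j).homMk h (map₂At F ν (Q.obj j).fiber) ⟶ (Q.obj j).lift h' :=
    ⟨ν, Category.comp_id _⟩
  refine ofElementsMap_eq Q _ (θ₀ ≫ (λ_ _).inv ≫ (Q.mapId j).inv ▷ _) ?_
  change ν ≫ (λ_ h').inv ≫ (Q.mapId j).inv.base ▷ h' =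
    ν ≫ (λ_ h').inv ≫ (𝟙 _ ≫ (Q.mapId j).inv.base) ▷ h'
  rw [Category.id_comp]

theorem ofElementsMap_comp {T : A} {a b c : Family (Q.comp (El.proj F)) T} (f : a ⟶ b)
    (g : b ⟶ c) : ofElementsMap Q (f ≫ g) = ofElementsMap Q f ≫ ofElementsMap Q g := by
  let θ₀ : (Q.obj a.idx).homMk a.leg (ofElementsMap Q f ≫ ofElementsMap Q g) ⟶
      Q.map f.base ≫ ofElementsHom Q g := ⟨f.cell, by
    change _ ≫ (mapCompAt F (Q.map f.base).base b.leg (Q.obj a.idx).fiber).hom ≫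
      (F.map b.leg).toFunctor.map (Q.map f.base).fiber ≫ ofElementsMap Q g =
      (map₂At F f.cell (Q.obj a.idx).fiber ≫
        (mapCompAt F (Q.map f.base).base b.leg (Q.obj a.idx).fiber).hom ≫
          (F.map b.leg).toFunctor.map (Q.map f.base).fiber ≫ 𝟙 _) ≫ ofElementsMap Q g
    exact comp_comp_id_comp _ _ _ _⟩
  refine ofElementsMap_eq Q _ (θ₀ ≫ Q.map f.base ◁ ofElementsCell Q g ≫ (α_ _ _ _).inv ≫
    (Q.mapComp f.base g.base).inv ▷ _) ?_
  change f.cell ≫ (Q.map f.base).base ◁ g.cell ≫ (α_ _ _ _).inv ≫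
      (Q.mapComp f.base g.base).inv.base ▷ c.leg =
    f.cell ≫ (Q.map f.base).base ◁ g.cell ≫ (α_ _ _ _).inv ≫
      (𝟙 _ ≫ (Q.mapComp f.base g.base).inv.base) ▷ c.leg
  rw [Category.id_comp]

/-- The functor that sends `(j, h)` to the image of the element `Q j` under `h`. -/
def ofElements (T : A) : Family (Q.comp (El.proj F)) T ⥤ F.obj T where
  obj a := (F.map a.leg).toFunctor.obj (Q.obj a.idx).fiber
  map f := ofElementsMap Q f
  map_id a := by
    rw [← Family.vert_id]
    exact (ofElementsMap_vert Q (𝟙 a.leg)).trans (map₂At_id F _ _)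
  map_comp f g := ofElementsMap_comp Q f g

theorem ofElements_natural {T T' : A} (g : T ⟶ T') {a b : Family (Q.comp (El.proj F)) T}
    (f : a ⟶ b) :
    ofElementsMap Q (Family.pushMap g f) ≫ (mapCompAt F b.leg g (Q.obj b.idx).fiber).hom =
      (mapCompAt F a.leg g (Q.obj a.idx).fiber).hom ≫
        (F.map g).toFunctor.map (ofElementsMap Q f) := by
  let θ := ofElementsCell Q f ▷ El.lift _ g ≫ (α_ _ _ _).hom
  have h : map₂At F (f.cell ▷ g ≫ (α_ _ _ _).hom) (Q.obj a.idx).fiber ≫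
      (mapCompAt F (Q.map f.base).base (b.leg ≫ g) (Q.obj a.idx).fiber).hom ≫
        (F.map (b.leg ≫ g)).toFunctor.map (Q.map f.base).fiber ≫
          (mapCompAt F b.leg g (Q.obj b.idx).fiber).hom ≫ (F.map g).toFunctor.map (𝟙 _) ≫ 𝟙 _ =
      (mapCompAt F a.leg g (Q.obj a.idx).fiber).hom ≫
        (F.map g).toFunctor.map (ofElementsMap Q f) ≫ 𝟙 _ := θ.w
  rw [CategoryTheory.Functor.map_id, Category.comp_id, Category.comp_id, Category.comp_id] at h
  rw [← h]
  exact (comp_comp_id_comp _ _ _ _).symm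

/-- The transformation that corresponds to a diagram of elements. -/
def transOfElements :
    families (Q.comp (El.proj F)) ⟶ F.comp catAsSmall.{max u v w u₁ v₁} :=
  ofSec (ofElements Q)
    (fun g => NatIso.ofComponents (fun a => mapCompAt F a.leg g (Q.obj a.idx).fiber)
      (fun f => ofElements_natural Q g f))
    (fun {T T' g g'} η a => by
      change ofElementsMap Q (Family.vert (a.leg ◁ η)) ≫ (mapCompAt F a.leg g' _).hom =
        (mapCompAt F a.leg g _).hom ≫ map₂At F η ((F.map a.leg).toFunctor.obj _)
      exact (congrArg (· ≫ _) (ofElementsMap_vert Q (a.leg ◁ η))).trans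
        (map₂At_whiskerLeft F a.leg η _))
    (fun T a => by
      change (mapCompAt F a.leg (𝟙 T) _).hom ≫ (mapIdAt F _).hom =
        ofElementsMap Q (Family.vert (ρ_ a.leg).hom)
      exact (map₂At_rightUnitor F a.leg _).symm.trans (ofElementsMap_vert Q (ρ_ a.leg).hom).symm)
    (fun {T T' T''} f g a => by
      change (mapCompAt F a.leg (f ≫ g) _).hom ≫ (mapCompAt F f g _).hom =
        ofElementsMap Q (Family.vert (α_ a.leg f g).inv) ≫ (mapCompAt F (a.leg ≫ f) g _).hom ≫
          (F.map g).toFunctor.map (mapCompAt F a.leg f _).hom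
      exact (map₂At_associator_inv F a.leg f g _).symm.trans
        (congrArg (· ≫ _) (ofElementsMap_vert Q (α_ a.leg f g).inv)).symm)

end Elements

/-! ### Diagrams of generic elements present `F`. -/

section Dense

variable {A : Type u} [Bicategory.{w, v} A] {F : A ⥤ᵖ Cat.{v₁, u₁}}
  {J : Type (max u v w u₁ v₁)} [Bicategory.{w₂, max u v w u₁ v₁} J] [IsLocallyDiscrete J]

/-- A diagram that presents the generic elements, and the generic morphisms between them up to
isomorphism. -/
structure PresentsGenerics (Q : J ⥤ᵖ El F) : Prop where
  obj_generic (j : J) : (Q.obj j).IsLaxElGeneric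
  map_generic {j k : J} (p : j ⟶ k) : IsGenericObj (Q.map p)
  exists_map_iso {j k : J} (f : Q.obj j ⟶ Q.obj k) (hf : IsGenericObj f) :
    ∃ p : j ⟶ k, Nonempty (Q.map p ≅ f)
  eq_of_iso {j k : J} {p q : j ⟶ k} (e : Q.map p ≅ Q.map q) : p = q
  exists_opcartesian (Y : El F) : ∃ (j : J) (f : Q.obj j ⟶ Y), El.IsOpcartesian f

namespace PresentsGenerics

variable {Q : J ⥤ᵖ El F}

/-- Both `Q p` and `Q q` compare with the strong lifting of `(a.leg, φ)` through the opcartesian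
lift of `b.leg`. These comparisons are invertible, so `p = q`; they then coincide by subterminality,
and cancelling the common one identifies the 2-cells. -/
theorem family_hom_eq (hQ : PresentsGenerics Q) {T : A} {a b : Family (Q.comp (El.proj F)) T}
    {φ : (F.map a.leg).toFunctor.obj (Q.obj a.idx).fiber ⟶
      (F.map b.leg).toFunctor.obj (Q.obj b.idx).fiber} {p q : a.idx ⟶ b.idx}
    (θ : (Q.obj a.idx).homMk a.leg φ ⟶ Q.map p ≫ (Q.obj b.idx).lift b.leg)
    (θ' : (Q.obj a.idx).homMk a.leg φ ⟶ Q.map q ≫ (Q.obj b.idx).lift b.leg) :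
    (⟨p, θ.base⟩ : a ⟶ b) = ⟨q, θ'.base⟩ := by
  obtain ⟨k, ν, H, -⟩ := hQ.obj_generic a.idx ((Q.obj a.idx).homMk a.leg φ)
    ((Q.obj b.idx).lift b.leg)
    (El.isOpcartesian_lift _ _)
  obtain ⟨m, hm, -⟩ := H.1 _ θ
  obtain ⟨m', hm', -⟩ := H.1 _ θ'
  have := (hQ.map_generic p).isIso H.2 m
  have := (hQ.map_generic q).isIso H.2 m'
  obtain rfl : p = q := hQ.eq_of_iso (asIso m ≪≫ (asIso m').symm)
  obtain rfl : m = m' := H.2 _ _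
  have e : θ = θ' := (cancel_mono (m ▷ (Q.obj b.idx).lift b.leg)).1 (hm.trans hm'.symm)
  rw [e]

theorem faithful (hQ : PresentsGenerics Q) (T : A) : (ofElements Q T).Faithful where
  map_injective {a b f g} h := by
    obtain ⟨p, ν⟩ := f
    obtain ⟨q, μ⟩ := g
    exact hQ.family_hom_eq (a := a) (b := b) (ofElementsCell Q (⟨p, ν⟩ : a ⟶ b))
      (⟨μ, h.symm⟩ : ofElementsHom Q (⟨p, ν⟩ : a ⟶ b) ⟶ Q.map q ≫ (Q.obj b.idx).lift b.leg)

/-- The strong lifting of `(a.leg, φ)` through the opcartesian lift of `b.leg` is generic, hence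
isomorphic to some `Q p`; the lifting 2-cell, adjusted by that isomorphism, is the cell of a
preimage of `φ`. -/
theorem full (hQ : PresentsGenerics Q) (T : A) : (ofElements Q T).Full where
  map_surjective {a b} φ := by
    obtain ⟨k, ν, H, -⟩ := hQ.obj_generic a.idx ((Q.obj a.idx).homMk a.leg φ)
      ((Q.obj b.idx).lift b.leg) (El.isOpcartesian_lift _ _)
    obtain ⟨p, ⟨e⟩⟩ := hQ.exists_map_iso k H.isGenericObj
    exact ⟨⟨p, (ν ≫ e.inv ▷ (Q.obj b.idx).lift b.leg).base⟩,
      ofElementsMap_eq Q _ (ν ≫ e.inv ▷ (Q.obj b.idx).lift b.leg) rfl⟩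

theorem essSurj (hQ : PresentsGenerics Q) (T : A) : (ofElements Q T).EssSurj where
  mem_essImage y := by
    obtain ⟨j, f, hf⟩ := hQ.exists_opcartesian ⟨T, y⟩
    exact ⟨⟨j, f.base⟩, ⟨@asIso _ _ _ _ f.fiber hf⟩⟩

theorem isEquivalence_fn (hQ : PresentsGenerics Q) (T : A) :
    (fn (transOfElements Q) T).IsEquivalence := by
  have h₁ : (ofElements Q T).IsEquivalence :=
    { faithful := hQ.faithful T, full := hQ.full T, essSurj := hQ.essSurj T }
  have h₂ : (AsSmall.up : F.obj T ⥤ AsSmall.{max u v w u₁ v₁} (F.obj T)).IsEquivalence :=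
    AsSmall.equiv.isEquivalence_functor
  exact @Functor.isEquivalence_trans _ _ _ _ _ _ _ _ h₁ h₂

end PresentsGenerics

end Dense

/-! ### The diagram of all lax el-generic objects. -/

section Generics

variable {A : Type u} [Bicategory.{w, v} A] (F : A ⥤ᵖ Cat.{v₁, u₁})

/-- The lax el-generic objects, if generic morphisms between them compose. -/
def El.genericSystem (h : ∀ (X Y Z : El F) (f : X ⟶ Y) (g : Y ⟶ Z),
    X.IsLaxElGeneric → Y.IsLaxElGeneric → Z.IsLaxElGeneric → IsElGenericMor f →
      IsElGenericMor g → IsElGenericMor (f ≫ g)) : GenericSystem (El F) where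
  carrier X := X.IsLaxElGeneric
  id_generic hX := hX.isGenericObj (El.isOpcartesian_id _)
  comp_generic hX hY hZ hf hg := (El.isElGenericMor_iff _).1 (h _ _ _ _ _ hX hY hZ
    ((El.isElGenericMor_iff _).2 hf) ((El.isElGenericMor_iff _).2 hg))

theorem GenericSystem.presentsGenerics_incl (G : GenericSystem (El F))
    (hG : ∀ X, G.carrier X ↔ X.IsLaxElGeneric)
    (h : ∀ Y : El F, ∃ (X : El F) (f : X ⟶ Y), X.IsLaxElGeneric ∧ El.IsOpcartesian f) :
    PresentsGenerics (Index.incl.{max u v w u₁ v₁} G) where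
  obj_generic j := (hG _).1 j.as.mem
  map_generic p := Index.rep_generic p.as
  exists_map_iso f hf := ⟨⟨Index.cls f hf⟩, ⟨Index.repIso f hf⟩⟩
  eq_of_iso e := Discrete.ext (Index.eq_of_iso e)
  exists_opcartesian Y := by
    obtain ⟨X, f, hX, hf⟩ := h Y
    exact ⟨⟨⟨X, (hG X).2 hX⟩⟩, f, hf⟩

end Generics

end LaxFamilial

theorem theorem3 {A : Type u} [Bicategory.{w, v} A] (F : A ⥤ᵖ Cat.{v₁, u₁}) :
    LaxFamilial.IsLaxConicalColimitOfRepresentables F ↔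
      (∀ Y : LaxFamilial.El F, ∃ (X : LaxFamilial.El F) (f : X ⟶ Y),
        X.IsLaxElGeneric ∧ LaxFamilial.El.IsOpcartesian f) ∧
      (∀ (X Y Z : LaxFamilial.El F) (f : X ⟶ Y) (g : Y ⟶ Z),
        X.IsLaxElGeneric → Y.IsLaxElGeneric → Z.IsLaxElGeneric →
          LaxFamilial.El.IsElGenericMor f → LaxFamilial.El.IsElGenericMor g →
            LaxFamilial.El.IsElGenericMor (f ≫ g)) := by
  rw [LaxFamilial.isLaxConicalColimitOfRepresentables_iff]
  constructor
  · rintro ⟨M, _, P, s, hs⟩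
    refine ⟨fun Y => ?_, fun X Y Z f g hX hY _ hf hg =>
      LaxFamilial.IsElGenericMor.comp s hX hY hf hg⟩
    obtain ⟨j, e, he⟩ := LaxFamilial.exists_opcartesian (s := s) Y
    exact ⟨_, e, LaxFamilial.gen_isLaxElGeneric s j, he⟩
  · rintro ⟨h, h'⟩
    -- The witnesses found by unification are the category of generic morphisms, its inclusion
    -- followed by the projection `El.proj F`, and `transOfElements` of the inclusion.
    exact ⟨_, inferInstance, _, _, ((LaxFamilial.El.genericSystem F h').presentsGenerics_incl F
      (fun _ => Iff.rfl) h).isEquivalence_fn⟩
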